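/- Let $K$ be a field, let $m\ge 1$ and $n\ge m+1$ be integers, let $S=K[x_1,\ldots,x_n]$ with the standard grading, and let $$I_{n,m}:=(x_1x_2\cdots x_m)\cap(x_{m+1},x_{m+2},\ldots,x_n)\subset S.$$ For a finitely generated graded $S$-module $M\neq 0$, let the Hilbert depth $\operatorname{hdepth}(M)$ be the maximal depth of a finitely generated graded $S$-module $N$ with the same Hilbert series as $M$. Then $$\operatorname{hdepth}(S/I_{n,m})=\max\left\{q\in\{0,1,\ldots,n\}\;:\;\binom{n-q+k-1}{k}-\binom{n-q+k-1-m}{k-m}\ge\binom{q-m}{k-m}\ \text{ for all integers } k \text{ with } m\le k\le q \text{ and } k-m \text{ odd}\right\}.$$ -/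

import Mathlib

universe u

namespace HilbertDepth

/-- `S = K[x_1, …, x_n]`; the variable `x_i` is `MvPolynomial.X` of the index `i - 1 : Fin n`. -/
abbrev PolyRing (K : Type u) [Field K] (n : ℕ) : Type u := MvPolynomial (Fin n) K

section Graded

variable {K : Type u} [Field K] {n : ℕ} {M : Type u} [AddCommGroup M] [Module K M]
  [Module (PolyRing K n) M]

/-- The `K`-subspaces `ℳ d` (`d ∈ ℤ`) make the `S`-module `M` a graded `S`-module, where `S` has
its standard grading (every variable has degree `1`):
`M = ⨁_d ℳ d` and `S_i • ℳ d ⊆ ℳ (d + i)`. -/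
structure IsGradedModule (ℳ : ℤ → Submodule K M) : Prop where
  isInternal : DirectSum.IsInternal ℳ
  smul_mem : ∀ (i : ℕ) (d : ℤ) (p : PolyRing K n) (y : M),
    p.IsHomogeneous i → y ∈ ℳ d → p • y ∈ ℳ (d + i)

variable (K n M) in
/-- The depth of a finitely generated graded `S`-module: the supremum of the lengths of the
`M`-regular sequences contained in the graded maximal ideal `(x_1, …, x_n)`
(used here for nonzero modules only). -/
noncomputable def depth : ℕ∞ :=
  ⨆ rs : {rs : List (PolyRing K n) // RingTheory.Sequence.IsRegular M rs ∧
    ∀ f ∈ rs, f ∈ Ideal.span (Set.range (MvPolynomial.X : Fin n → PolyRing K n))},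
    (rs.1.length : ℕ∞)

end Graded

/-- The `d`-th coefficient `dim_K (M_d)` of the Hilbert series of a graded module. -/
noncomputable def hilbertFunction {K : Type u} [Field K] {M : Type u} [AddCommGroup M]
    [Module K M] (ℳ : ℤ → Submodule K M) (d : ℤ) : ℕ :=
  Module.finrank K (ℳ d)

/-- The set of depths of the finitely generated graded `K[x_1, …, x_n]`-modules `N` that have the
same Hilbert series as the graded module `M = ⨁_d ℳ d`. -/
def depthsWithHilbertSeriesOf (n : ℕ) {K : Type u} [Field K] {M : Type u} [AddCommGroup M]
    [Module K M] (ℳ : ℤ → Submodule K M) : Set ℕ∞ :=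
  {e | ∃ (N : Type u) (_ : AddCommGroup N) (_ : Module K N) (_ : Module (PolyRing K n) N)
      (_ : IsScalarTower K (PolyRing K n) N) (𝒩 : ℤ → Submodule K N),
      IsGradedModule (n := n) 𝒩 ∧ Module.Finite (PolyRing K n) N ∧
      (∀ d : ℤ, hilbertFunction 𝒩 d = hilbertFunction ℳ d) ∧ depth K n N = e}

/-- The Hilbert depth of the graded `K[x_1, …, x_n]`-module `M = ⨁_d ℳ d`. -/
noncomputable def hdepth (n : ℕ) {K : Type u} [Field K] {M : Type u} [AddCommGroup M]
    [Module K M] (ℳ : ℤ → Submodule K M) : ℕ∞ :=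
  sSup (depthsWithHilbertSeriesOf n ℳ)

/-- The standard grading of `S / I`, for `I` a homogeneous ideal: the piece of degree `d` is the
image of the forms of degree `d` (and is zero for `d < 0`). -/
noncomputable def quotientGrading {K : Type u} [Field K] {n : ℕ} (I : Ideal (PolyRing K n)) :
    ℤ → Submodule K (PolyRing K n ⧸ I) := fun d =>
  if 0 ≤ d then
    (MvPolynomial.homogeneousSubmodule (Fin n) K d.toNat).map (Ideal.Quotient.mkₐ K I).toLinearMap
  else ⊥

/-- The ideal `I_{n,m} = (x_1 x_2 ⋯ x_m) ∩ (x_{m+1}, …, x_n)` of `K[x_1, …, x_n]`. -/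
noncomputable def idealI (K : Type u) [Field K] (n m : ℕ) : Ideal (PolyRing K n) :=
  Ideal.span {∏ i ∈ Finset.univ.filter (fun i : Fin n => (i : ℕ) < m), MvPolynomial.X i} ⊓
    Ideal.span {f | ∃ i : Fin n, m ≤ (i : ℕ) ∧ f = MvPolynomial.X i}

end HilbertDepth

/-! The Hilbert series of S/I_{n,m} is H = (1 - X^m)/(1 - X)^n + X^m/(1 - X)^m
(`hilbertFunction_idealI`). The Hilbert depth is the largest q ≤ n for which (1 - X)^q H has
nonnegative coefficients, and the binomial inequalities spell out this positivity
(`coeff_numerator_nonneg_iff`).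

Upper bound: let a finitely generated graded module with series H have a regular sequence of length
q in (x_1, …, x_n), not necessarily homogeneous. After base change to the algebraic closure, prime
avoidance and an exchange argument replace it by a sequence of linear forms
(`HasRegularSeq.of_span`). Factoring out a regular linear form multiplies the Hilbert series by 1 -
X, so (1 - X)^q H is again a Hilbert series (`iterate_backwardDiff_hilbertFunction_nonneg`).

Lower bound: let m ≤ q < n and let (1 - X)^q H be nonnegative. In large degrees it agrees with a sum
of series X^s/(1 - X)^r, and a nonnegative series with this property is itself such a sum. Hence H
is a sum of series X^s/(1 - X)^r with q ≤ r ≤ n (`hilbertSeries_mem_geomMonoid`). A direct sum of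
shifted polynomial rings in r ≥ q variables has series H, and x_1, …, x_q is regular on it
(`realizes_of_mem_geomMonoid`). -/

namespace HilbertDepth

/-! ### Regular sequences modulo submodules: exchange over an infinite field -/

section Exchange

variable {R N : Type*} [CommRing R] [AddCommGroup N] [Module R N]

/-- `f` is a nonzerodivisor on `N ⧸ U`. -/
def RegularMod (U : Submodule R N) (f : R) : Prop := ∀ y : N, f • y ∈ U → y ∈ U

/-- The submodule `U + f N`. -/
def addMul (U : Submodule R N) (f : R) : Submodule R N :=
  U ⊔ LinearMap.range (LinearMap.lsmul R N f)

theorem mem_addMul {U : Submodule R N} {f : R} {x : N} :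
    x ∈ addMul U f ↔ ∃ u ∈ U, ∃ y, u + f • y = x := by
  simp [addMul, Submodule.mem_sup]

theorem le_addMul (U : Submodule R N) (f : R) : U ≤ addMul U f := le_sup_left

theorem smul_mem_addMul (U : Submodule R N) (f : R) (y : N) : f • y ∈ addMul U f :=
  mem_addMul.2 ⟨0, U.zero_mem, y, zero_add _⟩

theorem addMul_comm (U : Submodule R N) (f g : R) :
    addMul (addMul U f) g = addMul (addMul U g) f := by
  simp only [addMul, sup_assoc]
  rw [sup_comm (LinearMap.range (LinearMap.lsmul R N f))]

/-- There is a weakly `N ⧸ U`-regular sequence of length `q` with all its members in `L`. -/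
def HasRegularSeq (L : Set R) : ℕ → Submodule R N → Prop
  | 0, _ => True
  | q + 1, U => ∃ f ∈ L, RegularMod U f ∧ HasRegularSeq L q (addMul U f)

/-- If f y = u + h z, then h z lies in U + fN, so z = v + f w with v in U; cancelling f puts y - h w
in U. This lets a new element `h` be moved in front of `f`. -/
theorem RegularMod.swap {U : Submodule R N} {f h : R} (hf : RegularMod U f)
    (hh : RegularMod (addMul U f) h) : RegularMod (addMul U h) f := by
  intro y hy
  obtain ⟨u, hu, z, hz⟩ := mem_addMul.1 hy
  have h1 : h • z ∈ addMul U f := by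
    refine mem_addMul.2 ⟨-u, U.neg_mem hu, y, ?_⟩
    rw [← hz]; abel
  obtain ⟨v, hv, w, hw⟩ := mem_addMul.1 (hh z h1)
  have h2 : f • (y - h • w) ∈ U := by
    have : f • (y - h • w) = u + h • v := by
      rw [smul_sub, ← hz, ← hw, smul_add, smul_comm f h w]; abel
    rw [this]
    exact U.add_mem hu (U.smul_mem _ hv)
  exact mem_addMul.2 ⟨_, hf _ h2, w, by abel⟩

variable {k : Type*} [Field k] [Infinite k] [Algebra k R] [IsNoetherianRing R] [IsNoetherian R N]

/-- Prime avoidance for a vector space of elements over an infinite field. -/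
theorem exists_regularMod_or (V : Submodule k R) (s : Finset (Submodule R N)) :
    (∃ h ∈ V, ∀ U ∈ s, RegularMod U h) ∨
      ∃ U ∈ s, ∃ y ∉ U, ∀ f ∈ Ideal.span (V : Set R), f • y ∈ U := by
  classical
  -- Either `V` lies in the annihilator of some nonzero class, or the associated primes cut out
  -- finitely many proper subspaces of `V`, which cannot cover it.
  by_cases hV : ∃ U ∈ s, ∃ P ∈ associatedPrimes R (N ⧸ U), (V : Set R) ⊆ P
  · right
    obtain ⟨U, hU, P, hP, hVP⟩ := hV
    obtain ⟨hPp, x, hx⟩ := isAssociatedPrime_iff.1 (AssociatedPrimes.mem_iff.1 hP)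
    obtain ⟨y, rfl⟩ := Submodule.Quotient.mk_surjective U x
    refine ⟨U, hU, y, ?_, ?_⟩
    · intro hy
      apply hPp.ne_top
      rw [hx, (Submodule.Quotient.mk_eq_zero U).2 hy]
      simp
    · intro f hf
      have hfP : f ∈ P := Ideal.span_le.2 hVP hf
      rw [hx, Submodule.mem_colon_singleton, ← Submodule.Quotient.mk_smul] at hfP
      exact (Submodule.Quotient.mk_eq_zero U).1 hfP
  · left
    push Not at hV
    have hfin : (⋃ U ∈ s, associatedPrimes R (N ⧸ U)).Finite :=
      Set.Finite.biUnion s.finite_toSet fun U _ => associatedPrimes.finite R (N ⧸ U)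
    let c : Ideal R → Submodule k V := fun P => (P.restrictScalars k).comap V.subtype
    have hne := Subspace.biUnion_ne_univ_of_top_notMem (k := k) (E := V)
      (s := hfin.toFinset.image c) (by
        simp only [Finset.mem_image, Set.Finite.mem_toFinset, Set.mem_iUnion, not_exists, not_and]
        rintro P ⟨U, hU, hP⟩ htop
        refine hV U hU P hP fun v hv => ?_
        have : (⟨v, hv⟩ : V) ∈ c P := htop ▸ Submodule.mem_top
        exact this)
    obtain ⟨v, hv⟩ := (Set.ne_univ_iff_exists_notMem _).1 hne
    refine ⟨v, v.2, fun U hU y hy => ?_⟩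
    by_contra hyU
    apply hv
    have hz : (v : R) ∈ ⋃ p ∈ associatedPrimes R (N ⧸ U), (p : Set R) := by
      rw [biUnion_associatedPrimes_eq_zero_divisors]
      refine ⟨Submodule.Quotient.mk y, ?_, ?_⟩
      · rwa [Ne, Submodule.Quotient.mk_eq_zero]
      · rw [← Submodule.Quotient.mk_smul, Submodule.Quotient.mk_eq_zero]; exact hy
    simp only [Set.mem_iUnion] at hz ⊢
    obtain ⟨P, hP, hvP⟩ := hz
    refine ⟨c P, Finset.mem_image_of_mem _ ?_, hvP⟩
    rw [Set.Finite.mem_toFinset]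
    exact Set.mem_biUnion hU hP

/-- Passing to the quotient by a nonzerodivisor shortens the longest regular sequence by at most
one. -/
theorem HasRegularSeq.addMul_of_regularMod (V : Submodule k R) (q : ℕ) :
    ∀ (U : Submodule R N) (g : R), g ∈ Ideal.span (V : Set R) → RegularMod U g →
      HasRegularSeq (Ideal.span (V : Set R) : Set R) (q + 1) U →
      HasRegularSeq (Ideal.span (V : Set R) : Set R) q (addMul U g) := by
  classical
  induction q with
  | zero => intros; trivial
  | succ q ih =>
    rintro U g hg hgU ⟨f, hf, hfU, f₂, hf₂, hf₂U, hrest⟩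
    rcases exists_regularMod_or V {U, addMul U f, addMul U g} with ⟨h, hhV, hh⟩ | ⟨W, hW, y, hy, hmy⟩
    -- A common regular `h` mediates: induction removes `h` from the sequence on U + fN, then
    -- removes `g` from the resulting sequence f, … on U + hN.
    · have h1 := hh U (by simp)
      have h2 := hh (addMul U f) (by simp)
      have h3 := hh (addMul U g) (by simp)
      have hhm : h ∈ Ideal.span (V : Set R) := Ideal.subset_span hhV
      have hA : HasRegularSeq (Ideal.span (V : Set R) : Set R) q (addMul (addMul U h) f) := by
        rw [addMul_comm]
        exact ih (addMul U f) h hhm h2 ⟨f₂, hf₂, hf₂U, hrest⟩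
      have hB := ih (addMul U h) g hg (hgU.swap h3) ⟨f, hf, hfU.swap h2, hA⟩
      rw [addMul_comm] at hB
      exact ⟨h, hhm, h3, hB⟩
    · exfalso
      simp only [Finset.mem_insert, Finset.mem_singleton] at hW
      rcases hW with rfl | rfl | rfl
      · exact hy (hfU y (hmy f hf))
      · exact hy (hf₂U y (hmy f₂ hf₂))
      -- The pair `f`, `f₂` excludes a class y killed modulo U + gN. Comparing f y = u + g z with f₂
      -- y = u' + g z' and cancelling `g` gives f₂ z ∈ U + fN, so z ∈ U + fN, and cancelling `f`
      -- gives y ∈ U + gN.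
      · obtain ⟨u, hu, z, hz⟩ := mem_addMul.1 (hmy f hf)
        have hzU : z ∈ addMul U f := by
          apply hf₂U
          obtain ⟨u', hu', z', hz'⟩ := mem_addMul.1 (hmy f₂ hf₂)
          have : g • (f₂ • z - f • z') ∈ U := by
            have : g • (f₂ • z - f • z') = f • u' - f₂ • u := by
              rw [smul_sub, smul_comm g f₂, smul_comm g f, eq_sub_iff_add_eq'.2 hz,
                eq_sub_iff_add_eq'.2 hz', smul_sub, smul_sub, smul_comm f f₂]
              abel
            rw [this]
            exact U.sub_mem (U.smul_mem _ hu') (U.smul_mem _ hu)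
          exact mem_addMul.2 ⟨_, hgU _ this, z', by abel⟩
        obtain ⟨u', hu', z', rfl⟩ := mem_addMul.1 hzU
        apply hy
        have : f • (y - g • z') ∈ U := by
          have : f • (y - g • z') = u + g • u' := by
            rw [smul_sub, ← hz, smul_add, smul_comm f g]; abel
          rw [this]
          exact U.add_mem hu (U.smul_mem _ hu')
        exact mem_addMul.2 ⟨_, hfU _ this, z', by abel⟩

/-- Over an infinite field, a regular sequence in the ideal generated by a vector space `V` can be
replaced by one consisting of elements of `V`. -/
theorem HasRegularSeq.of_span (V : Submodule k R) (q : ℕ) : ∀ U : Submodule R N,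
    HasRegularSeq (Ideal.span (V : Set R) : Set R) q U → HasRegularSeq (V : Set R) q U := by
  induction q with
  | zero => intros; trivial
  | succ q ih =>
    rintro U ⟨f, hf, hfU, hrest⟩
    rcases exists_regularMod_or V {U} with ⟨h, hhV, hh⟩ | ⟨W, hW, y, hy, hmy⟩
    · have hhU := hh U (by simp)
      exact ⟨h, hhV, hhU, ih _ (addMul_of_regularMod V q U h (Ideal.subset_span hhV) hhU
        ⟨f, hf, hfU, hrest⟩)⟩
    · rw [Finset.mem_singleton] at hW
      subst hW
      exact absurd (hfU y (hmy f hf)) hy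

end Exchange

/-! ### Weakly regular lists -/

section WeaklyRegular

open RingTheory.Sequence

variable {R N : Type*} [CommRing R] [AddCommGroup N] [Module R N]

theorem hasRegularSeq_of_isWeaklyRegular {rs : List R} (h : IsWeaklyRegular N rs) (L : Set R)
    (hL : ∀ f ∈ rs, f ∈ L) : HasRegularSeq L rs.length (⊥ : Submodule R N) := by
  have key : ∀ d j, j + d = rs.length →
      HasRegularSeq L d (Ideal.ofList (rs.take j) • ⊤ : Submodule R N) := by
    intro d
    induction d with
    | zero => intros; trivial
    | succ d ih =>
      intro j hj
      have hjl : j < rs.length := by omega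
      refine ⟨rs[j], hL _ (List.getElem_mem hjl), ?_, ?_⟩
      · intro y hy
        have := h.regular_mod_prev j hjl
        rw [← Submodule.Quotient.mk_eq_zero]
        apply this
        simpa only [smul_zero, ← Submodule.Quotient.mk_smul, Submodule.Quotient.mk_eq_zero] using hy
      · have := ih (j + 1) (by omega)
        rw [List.take_add_one, Ideal.ofList_append, Submodule.sup_smul] at this
        rw [List.getElem?_eq_getElem hjl, Option.toList_some, Ideal.ofList_singleton,
          Submodule.ideal_span_singleton_smul] at this
        convert this using 2
        rw [addMul, LinearMap.range_eq_map]
        rfl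
  simpa using key rs.length 0 (by omega)

theorem isWeaklyRegular_take {rs : List R} (h : IsWeaklyRegular N rs) (j : ℕ) :
    IsWeaklyRegular N (rs.take j) := by
  rw [← List.take_append_drop j rs] at h
  exact ((isWeaklyRegular_append_iff _ _ _).1 h).1

end WeaklyRegular

end HilbertDepth

/-! ### Differences of Hilbert functions -/

namespace HilbertDepth

/-- The backward difference `d ↦ a d - a (d - 1)`. -/
def backwardDiff (a : ℤ → ℤ) : ℤ → ℤ := fun d => a d - a (d - 1)

theorem finrank_map_add_finrank_inf_ker {k E F : Type*} [Field k] [AddCommGroup E] [Module k E]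
    [AddCommGroup F] [Module k F] (f : E →ₗ[k] F) (A : Submodule k E) [FiniteDimensional k A] :
    Module.finrank k (A.map f) + Module.finrank k (A ⊓ LinearMap.ker f : Submodule k E) =
      Module.finrank k A := by
  rw [← LinearMap.finrank_range_add_finrank_ker (f.domRestrict A), LinearMap.range_domRestrict,
    LinearMap.ker_domRestrict]
  rw [← Submodule.map_comap_subtype, Submodule.finrank_map_subtype_eq]

section Difference

variable {k R N : Type*} [Field k] [CommRing R] [Algebra k R] [AddCommGroup N] [Module R N]
  [Module k N] [IsScalarTower k R N]

/-- The Hilbert function of `N ⧸ U`, where the piece of degree `d` of `N` is the range of `π d`. -/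
noncomputable def hilbertMod (π : ℤ → N →ₗ[k] N) (U : Submodule R N) (d : ℤ) : ℤ :=
  (Module.finrank k (LinearMap.range (π d)) : ℤ) -
    Module.finrank k (LinearMap.range (π d) ⊓ U.restrictScalars k : Submodule k N)

variable (π : ℤ → N →ₗ[k] N) (hπ : ∀ d y, π d (π d y) = π d y)
  [∀ d, FiniteDimensional k (LinearMap.range (π d))]

include hπ in
-- This is the exact sequence 0 → (N/U)(-1) → N/U → N/(U + hN) → 0, counted inside N so that no
-- grading on a quotient is needed. In degree d + 1, U + hN is the sum of the piece of U and h N_d,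
-- and regularity makes their intersection h(U ∩ N_d).
theorem hilbertMod_addMul {h : R} (hh : ∀ d y, π (d + 1) (h • y) = h • π d y)
    {U : Submodule R N} (hU : ∀ d, ∀ y ∈ U, π d y ∈ U) (hreg : RegularMod U h) (d : ℤ) :
    hilbertMod π (addMul U h) (d + 1) = hilbertMod π U (d + 1) - hilbertMod π U d := by
  set l : N →ₗ[k] N := Algebra.lsmul k k N h
  have hl : ∀ y, l y = h • y := fun y => rfl
  have hfix : ∀ {d y}, y ∈ LinearMap.range (π d) → π d y = y := by
    rintro d _ ⟨y, rfl⟩; exact hπ d y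
  have e1 : (LinearMap.range (π (d + 1)) ⊓ (addMul U h).restrictScalars k : Submodule k N) =
      (LinearMap.range (π (d + 1)) ⊓ U.restrictScalars k) ⊔ (LinearMap.range (π d)).map l := by
    apply le_antisymm
    · rintro y ⟨hy, hyU⟩
      obtain ⟨u, hu, z, hz⟩ := mem_addMul.1 hyU
      have : y = π (d + 1) u + h • π d z := by
        rw [← hh, ← map_add, hz, hfix hy]
      rw [this]
      exact Submodule.add_mem_sup ⟨⟨u, rfl⟩, hU _ _ hu⟩ ⟨_, ⟨z, rfl⟩, rfl⟩
    · refine sup_le (inf_le_inf_left _ (le_addMul U h)) ?_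
      rintro _ ⟨_, ⟨z, rfl⟩, rfl⟩
      exact ⟨⟨h • z, hh d z⟩, smul_mem_addMul _ _ _⟩
  have e2 : (LinearMap.range (π (d + 1)) ⊓ U.restrictScalars k) ⊓ (LinearMap.range (π d)).map l =
      (LinearMap.range (π d) ⊓ U.restrictScalars k).map l := by
    apply le_antisymm
    · rintro _ ⟨⟨-, hy⟩, z, hz, rfl⟩
      exact ⟨z, ⟨hz, hreg z hy⟩, rfl⟩
    · rintro _ ⟨z, ⟨hz, hzU⟩, rfl⟩
      refine ⟨⟨⟨h • z, ?_⟩, U.smul_mem h hzU⟩, z, hz, rfl⟩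
      rw [hh, hfix hz, hl]
  -- The kernel of `h` lies in U, so it contributes equally to the rank counts for N_d and U ∩ N_d
  -- and cancels.
  have hker : LinearMap.ker l ≤ U.restrictScalars k := by
    intro y hy
    refine hreg y ?_
    rw [← hl, LinearMap.mem_ker.1 hy]
    exact U.zero_mem
  have r1 := finrank_map_add_finrank_inf_ker l (LinearMap.range (π d))
  have r2 := finrank_map_add_finrank_inf_ker l
    (LinearMap.range (π d) ⊓ U.restrictScalars k : Submodule k N)
  rw [inf_assoc, inf_eq_right.2 hker] at r2
  have r3 := Submodule.finrank_sup_add_finrank_inf_eq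
    (LinearMap.range (π (d + 1)) ⊓ U.restrictScalars k : Submodule k N)
    ((LinearMap.range (π d)).map l)
  rw [← e1, e2] at r3
  unfold hilbertMod
  omega

include hπ in
theorem iterate_backwardDiff_hilbertMod_nonneg (V : Submodule k R)
    (hV : ∀ h ∈ V, ∀ d y, π (d + 1) (h • y) = h • π d y) (q : ℕ) :
    ∀ U : Submodule R N, (∀ d, ∀ y ∈ U, π d y ∈ U) → HasRegularSeq (V : Set R) q U →
      ∀ d, 0 ≤ backwardDiff^[q] (hilbertMod π U) d := by
  induction q with
  | zero =>
    intro U _ _ d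
    have := Submodule.finrank_mono
      (inf_le_left : LinearMap.range (π d) ⊓ U.restrictScalars k ≤ LinearMap.range (π d))
    simp only [Function.iterate_zero, id_eq, hilbertMod]
    omega
  | succ q ih =>
    rintro U hU ⟨h, hhV, hreg, hrest⟩ d
    have hstep : backwardDiff (hilbertMod π U) = hilbertMod π (addMul U h) := by
      funext e
      have := hilbertMod_addMul π hπ (hV h hhV) hU hreg (e - 1)
      rw [sub_add_cancel] at this
      rw [this, backwardDiff]
    rw [Function.iterate_succ_apply, hstep]
    refine ih _ (fun e y hy => ?_) hrest d
    obtain ⟨u, hu, z, rfl⟩ := mem_addMul.1 hy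
    have := hV h hhV (e - 1) z
    rw [sub_add_cancel] at this
    rw [map_add, this]
    exact mem_addMul.2 ⟨_, hU _ _ hu, _, rfl⟩

include hπ in
/-- If a graded module with finite-dimensional pieces has a weakly regular sequence of length `q`
in the ideal generated by a space `V` of elements of degree one, then the `q`-th difference of its
Hilbert function is nonnegative. -/
theorem iterate_backwardDiff_finrank_nonneg [Infinite k] [IsNoetherianRing R] [IsNoetherian R N]
    (V : Submodule k R) (hV : ∀ h ∈ V, ∀ d y, π (d + 1) (h • y) = h • π d y)
    {rs : List R} (hrs : RingTheory.Sequence.IsWeaklyRegular N rs)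
    (hmem : ∀ f ∈ rs, f ∈ Ideal.span (V : Set R)) (d : ℤ) :
    0 ≤ backwardDiff^[rs.length] (fun d => (Module.finrank k (LinearMap.range (π d)) : ℤ)) d := by
  have h1 := (hasRegularSeq_of_isWeaklyRegular hrs _ hmem).of_span V
  have h2 := iterate_backwardDiff_hilbertMod_nonneg π hπ V hV rs.length ⊥
    (fun d y hy => by rw [(Submodule.mem_bot R).1 hy, map_zero]; exact Submodule.zero_mem _) h1 d
  convert h2 using 3
  rw [hilbertMod, Submodule.restrictScalars_bot, inf_bot_eq, finrank_bot]
  simp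

end Difference

end HilbertDepth

namespace HilbertDepth
open TensorProduct

/-! ### Gradings encoded by projections -/

section Projections

variable {k E : Type*} [Field k] [AddCommGroup E] [Module k E]

theorem exists_projections {ℳ : ℤ → Submodule k E} (h : DirectSum.IsInternal ℳ) :
    ∃ π : ℤ → E →ₗ[k] E, (∀ d y, π d y ∈ ℳ d) ∧ (∀ d, ∀ y ∈ ℳ d, π d y = y) ∧
      ∀ d e, e ≠ d → ∀ y ∈ ℳ e, π d y = 0 := by
  let _ := h.chooseDecomposition
  refine ⟨fun d => (ℳ d).subtype ∘ₗ DirectSum.component k ℤ (fun i => ℳ i) d ∘ₗ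
    (DirectSum.decomposeLinearEquiv ℳ).toLinearMap, fun d y => ?_, fun d y hy => ?_,
    fun d e hed y hy => ?_⟩
  · exact Subtype.prop _
  · exact DirectSum.decompose_of_mem_same ℳ hy
  · exact DirectSum.decompose_of_mem_ne ℳ hy hed

theorem isInternal_of_projections {ℳ : ℤ → Submodule k E} (hsup : ⨆ d, ℳ d = ⊤)
    (π : ℤ → E →ₗ[k] E) (h1 : ∀ d, ∀ y ∈ ℳ d, π d y = y)
    (h2 : ∀ d e, e ≠ d → ∀ y ∈ ℳ e, π d y = 0) : DirectSum.IsInternal ℳ := by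
  rw [DirectSum.isInternal_submodule_iff_iSupIndep_and_iSup_eq_top]
  refine ⟨fun d => ?_, hsup⟩
  rw [Submodule.disjoint_def]
  intro y hy hy'
  have : (⨆ e, ⨆ (_ : e ≠ d), ℳ e) ≤ LinearMap.ker (π d) :=
    iSup₂_le fun e he y hy => h2 d e he y hy
  rw [← h1 d y hy]
  exact this hy'

end Projections

/-! ### Finiteness of graded pieces and base change to the algebraic closure -/

section Graded

variable {K : Type u} [Field K] {n : ℕ} {N : Type u} [AddCommGroup N] [Module K N]
  [Module (MvPolynomial (Fin n) K) N] [IsScalarTower K (MvPolynomial (Fin n) K) N]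

/-- Finitely many homogeneous elements g generate N, and the piece of degree d is spanned by the
products x^a g with |a| = d - deg g. -/
theorem finiteDimensional_of_graded [Module.Finite (MvPolynomial (Fin n) K) N]
    {𝒩 : ℤ → Submodule K N} (hint : DirectSum.IsInternal 𝒩)
    (hsmul : ∀ (i : ℕ) (d : ℤ) (p : MvPolynomial (Fin n) K) (y : N),
      p.IsHomogeneous i → y ∈ 𝒩 d → p • y ∈ 𝒩 (d + i)) (d : ℤ) :
    FiniteDimensional K (𝒩 d) := by
  classical
  obtain ⟨π, -, h1, h2⟩ := exists_projections hint
  have htop : Submodule.span (MvPolynomial (Fin n) K) (⋃ e, (𝒩 e : Set N)) = ⊤ := by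
    rw [eq_top_iff]
    intro y _
    have hy : y ∈ ⨆ e, 𝒩 e := hint.submodule_iSup_eq_top ▸ Submodule.mem_top
    refine Submodule.iSup_induction 𝒩
      (motive := fun y => y ∈ Submodule.span (MvPolynomial (Fin n) K) (⋃ e, (𝒩 e : Set N))) hy
      (fun e y hy => Submodule.subset_span (Set.mem_iUnion.2 ⟨e, hy⟩)) (Submodule.zero_mem _)
      fun y z hy hz => Submodule.add_mem _ hy hz
  have hfg : (Submodule.span (MvPolynomial (Fin n) K) (⋃ e, (𝒩 e : Set N))).FG := by
    rw [htop]; exact Module.Finite.fg_top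
  rw [Submodule.fg_span_iff_fg_span_finset_subset] at hfg
  obtain ⟨G, hG, hGs⟩ := hfg
  rw [htop] at hGs
  have hdeg : ∀ g : N, ∃ e : ℤ, g ∈ G → g ∈ 𝒩 e := by
    intro g
    by_cases hg : g ∈ G
    · obtain ⟨e, he⟩ := Set.mem_iUnion.1 (hG hg)
      exact ⟨e, fun _ => he⟩
    · exact ⟨0, fun h => absurd h hg⟩
  choose deg hdeg using hdeg
  -- For d < deg g the truncation in `toNat` only adds g itself, which is harmless: the span of `B`
  -- need only contain the piece.
  let B : Finset N := G.biUnion fun g =>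
    ((Finset.univ : Finset (Fin n)).finsuppAntidiag (d - deg g).toNat).image
      fun a => MvPolynomial.monomial a (1 : K) • g
  have hspan := Submodule.span_smul_of_span_eq_top (R := K)
    (MvPolynomial.basisMonomials (Fin n) K).span_eq (G : Set N)
  rw [← hGs, Submodule.restrictScalars_top] at hspan
  have hle : 𝒩 d ≤ Submodule.span K (B : Set N) := by
    intro y hy
    rw [← h1 d y hy]
    have hy' : y ∈ (⊤ : Submodule K N) := Submodule.mem_top
    rw [← hspan] at hy'
    clear hy
    induction hy' using Submodule.span_induction with
    | mem y hy =>
      obtain ⟨_, ⟨a, rfl⟩, g, hg, rfl⟩ := hy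
      simp only [MvPolynomial.coe_basisMonomials]
      have hm := hsmul _ (deg g) _ g
        (MvPolynomial.isHomogeneous_monomial (1 : K) (n := a.degree) rfl) (hdeg g hg)
      by_cases hd : deg g + (a.degree : ℕ) = d
      · rw [h1 d _ (hd ▸ hm)]
        apply Submodule.subset_span
        simp only [B, Finset.coe_biUnion, Set.mem_iUnion, Finset.coe_image]
        refine ⟨g, hg, a, ?_, rfl⟩
        simp only [Finset.mem_coe, Finset.mem_finsuppAntidiag, Finset.subset_univ, and_true]
        rw [← Finsupp.degree_eq_sum]
        omega
      · rw [h2 d _ hd _ hm]; exact Submodule.zero_mem _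
    | zero => rw [map_zero]; exact Submodule.zero_mem _
    | add y z _ _ hy hz => rw [map_add]; exact Submodule.add_mem _ hy hz
    | smul c y _ hy => rw [map_smul]; exact Submodule.smul_mem _ _ hy
  have : FiniteDimensional K (Submodule.span K (B : Set N)) :=
    FiniteDimensional.span_finset K B
  exact Submodule.finiteDimensional_of_le hle

/-- Factor `f` through its range: base change keeps the surjection surjective and, by flatness, the
inclusion injective. -/
theorem finrank_range_baseChange (K' : Type*) [Field K'] [Algebra K K'] {E : Type*}
    [AddCommGroup E] [Module K E] (f : E →ₗ[K] E) :
    Module.finrank K' (LinearMap.range (f.baseChange K')) =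
      Module.finrank K (LinearMap.range f) := by
  have hf : f.baseChange K' = (LinearMap.range f).subtype.baseChange K' ∘ₗ
      f.rangeRestrict.baseChange K' := by
    rw [← LinearMap.baseChange_comp]; rfl
  rw [hf, LinearMap.range_comp_of_range_eq_top, LinearMap.finrank_range_of_inj,
    Module.finrank_baseChange]
  · exact Module.Flat.lTensor_preserves_injective_linearMap (M := K') _
      (Submodule.injective_subtype _)
  · exact LinearMap.range_eq_top.2 (LinearMap.lTensor_surjective K' f.surjective_rangeRestrict)

theorem finiteDimensional_range_baseChange (K' : Type*) [Field K'] [Algebra K K'] {E : Type*}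
    [AddCommGroup E] [Module K E] (f : E →ₗ[K] E) [FiniteDimensional K (LinearMap.range f)] :
    FiniteDimensional K' (LinearMap.range (f.baseChange K')) := by
  have hf : f.baseChange K' = (LinearMap.range f).subtype.baseChange K' ∘ₗ
      f.rangeRestrict.baseChange K' := by
    rw [← LinearMap.baseChange_comp]; rfl
  rw [hf, LinearMap.range_comp_of_range_eq_top]
  · infer_instance
  · exact LinearMap.range_eq_top.2 (LinearMap.lTensor_surjective K' f.surjective_rangeRestrict)

attribute [local instance] MvPolynomial.algebraMvPolynomial in
/-- The `q`-th difference of the Hilbert function of a finitely generated graded module with a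
weakly regular sequence of length `q` in `(x_1, …, x_n)` is nonnegative. -/
theorem iterate_backwardDiff_hilbertFunction_nonneg [Module.Finite (MvPolynomial (Fin n) K) N]
    {𝒩 : ℤ → Submodule K N} (hint : DirectSum.IsInternal 𝒩)
    (hsmul : ∀ (i : ℕ) (d : ℤ) (p : MvPolynomial (Fin n) K) (y : N),
      p.IsHomogeneous i → y ∈ 𝒩 d → p • y ∈ 𝒩 (d + i))
    {rs : List (MvPolynomial (Fin n) K)} (hrs : RingTheory.Sequence.IsWeaklyRegular N rs)
    (hmem : ∀ f ∈ rs, f ∈ Ideal.span (Set.range (MvPolynomial.X : Fin n → MvPolynomial (Fin n) K)))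
    (d : ℤ) : 0 ≤ backwardDiff^[rs.length] (fun d => (hilbertFunction 𝒩 d : ℤ)) d := by
  obtain ⟨π, h0, h1, h2⟩ := exists_projections hint
  have hrange : ∀ d, LinearMap.range (π d) = 𝒩 d := fun d => le_antisymm
    (by rintro _ ⟨y, rfl⟩; exact h0 d y) fun y hy => ⟨y, h1 d y hy⟩
  have hX : ∀ i d y, π (d + 1) ((MvPolynomial.X i : MvPolynomial (Fin n) K) • y) =
      (MvPolynomial.X i : MvPolynomial (Fin n) K) • π d y := by
    intro i d y
    have hy : y ∈ ⨆ e, 𝒩 e := hint.submodule_iSup_eq_top ▸ Submodule.mem_top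
    refine Submodule.iSup_induction 𝒩 (motive := fun y => π (d + 1)
      ((MvPolynomial.X i : MvPolynomial (Fin n) K) • y) =
        (MvPolynomial.X i : MvPolynomial (Fin n) K) • π d y) hy (fun e y hy => ?_) (by simp)
      fun y z hy hz => by rw [smul_add, map_add, hy, hz, map_add, smul_add]
    · have hXy := hsmul 1 e _ y (MvPolynomial.isHomogeneous_X K i) hy
      by_cases hed : e = d
      · subst hed
        rw [h1 e y hy]; exact h1 _ _ hXy
      · rw [h2 d e hed y hy, smul_zero, h2 _ _ (by push_cast; omega) _ hXy]
  have hfd : ∀ d, FiniteDimensional K (LinearMap.range (π d)) := fun d => by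
    rw [hrange]; exact finiteDimensional_of_graded hint hsmul d
  -- Prime avoidance by linear forms needs an infinite field. S' is flat over S, so the sequence
  -- stays weakly regular after base change.
  let K' := AlgebraicClosure K
  let S := MvPolynomial (Fin n) K
  let S' := MvPolynomial (Fin n) K'
  let N' := S' ⊗[S] N
  have halgX : ∀ i, algebraMap S S' (MvPolynomial.X i) = MvPolynomial.X i :=
    fun i => MvPolynomial.map_X (algebraMap K K') i
  have hflat : Module.Flat S S' :=
    Module.Flat.isBaseChange K S K' S' (Algebra.IsPushout.out (R := K) (S := S))
  -- The S'-action is visible on S' ⊗ N over S, the projections and their ranks on K' ⊗ N over K;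
  -- `e` transports between the two.
  let e : N' ≃ₗ[K'] K' ⊗[K] N := Algebra.IsPushout.cancelBaseChange K K' S S' N
  have he : ∀ y : N, e.symm (1 ⊗ₜ y) = 1 ⊗ₜ[S] y := fun y => by
    rw [Algebra.IsPushout.cancelBaseChange_symm_tmul, map_one]
  let π' : ℤ → N' →ₗ[K'] N' := fun d =>
    e.symm.toLinearMap ∘ₗ (π d).baseChange K' ∘ₗ e.toLinearMap
  have hπ'1 : ∀ d (y : N), π' d (1 ⊗ₜ[S] y) = 1 ⊗ₜ[S] π d y := by
    intro d y
    simp only [π', LinearMap.comp_apply, LinearEquiv.coe_coe, ← he, LinearEquiv.apply_symm_apply,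
      LinearMap.baseChange_tmul]
  have hind : ∀ f g : N' →ₗ[K'] N', (∀ y : N, f (1 ⊗ₜ[S] y) = g (1 ⊗ₜ[S] y)) → f = g := by
    intro f g hfg
    have : f ∘ₗ e.symm.toLinearMap = g ∘ₗ e.symm.toLinearMap := by
      ext y
      simpa [he] using hfg y
    ext1 z
    simpa using LinearMap.congr_fun this (e z)
  have hidem : ∀ d z, π' d (π' d z) = π' d z := by
    intro d z
    refine LinearMap.congr_fun (hind (π' d ∘ₗ π' d) (π' d) fun y => ?_) z
    rw [LinearMap.comp_apply, hπ'1, hπ'1, h1 d _ (h0 d y)]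
  have hX' : ∀ i d z, π' (d + 1) ((MvPolynomial.X i : S') • z) =
      (MvPolynomial.X i : S') • π' d z := by
    intro i d z
    refine LinearMap.congr_fun (hind (π' (d + 1) ∘ₗ Algebra.lsmul K' K' N' (MvPolynomial.X i : S'))
      (Algebra.lsmul K' K' N' (MvPolynomial.X i : S') ∘ₗ π' d) fun y => ?_) z
    have hXt : ∀ y : N, (MvPolynomial.X i : S') • ((1 : S') ⊗ₜ[S] y) =
        1 ⊗ₜ[S] ((MvPolynomial.X i : S) • y) := by
      intro y
      rw [TensorProduct.tmul_smul, ← algebraMap_smul S' (MvPolynomial.X i : S)]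
      rw [halgX]
    simp only [LinearMap.comp_apply, Algebra.lsmul_coe, hπ'1, hXt, hX]
  let V : Submodule K' S' := Submodule.span K' (Set.range MvPolynomial.X)
  have hV : ∀ h ∈ V, ∀ d z, π' (d + 1) (h • z) = h • π' d z := by
    intro h hh d z
    induction hh using Submodule.span_induction with
    | mem h hh => obtain ⟨i, rfl⟩ := hh; exact hX' i d z
    | zero => simp
    | add h h' _ _ hh hh' => rw [add_smul, map_add, hh, hh', add_smul]
    | smul c h _ hh => rw [smul_assoc, map_smul, hh, smul_assoc]
  have hr' : ∀ d, LinearMap.range (π' d) =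
      (LinearMap.range ((π d).baseChange K')).map e.symm.toLinearMap := by
    intro d
    rw [LinearMap.range_comp, LinearMap.range_comp_of_range_eq_top _ e.range]
  have hfd' : ∀ d, FiniteDimensional K' (LinearMap.range (π' d)) := by
    intro d
    have := finiteDimensional_range_baseChange K' (π d)
    rw [hr']
    infer_instance
  have hfr : ∀ d, Module.finrank K' (LinearMap.range (π' d)) = hilbertFunction 𝒩 d := by
    intro d
    rw [hr', hilbertFunction, ← hrange d, ← finrank_range_baseChange K' (π d)]
    exact LinearEquiv.finrank_map_eq e.symm _
  have hreg : RingTheory.Sequence.IsWeaklyRegular N' (rs.map (algebraMap S S')) :=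
    hrs.of_flat_of_isBaseChange (TensorProduct.isBaseChange S N S')
  have hmem' : ∀ f ∈ rs.map (algebraMap S S'), f ∈ Ideal.span (V : Set S') := by
    intro f hf
    obtain ⟨p, hp, rfl⟩ := List.mem_map.1 hf
    have := Ideal.mem_map_of_mem (algebraMap S S') (hmem p hp)
    rw [Ideal.map_span] at this
    refine Ideal.span_mono ?_ this
    rintro _ ⟨_, ⟨i, rfl⟩, rfl⟩
    refine Submodule.subset_span ⟨i, ?_⟩
    exact (halgX i).symm
  have := iterate_backwardDiff_finrank_nonneg π' hidem V hV hreg hmem' d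
  simpa only [hfr, List.length_map] using this

end Graded

end HilbertDepth

namespace HilbertDepth

/-! ### Shifts and direct sums of graded modules -/

section Shift

variable {K : Type u} [Field K] {n : ℕ} {N : Type u} [AddCommGroup N] [Module K N]
  [Module (PolyRing K n) N]

theorem IsGradedModule.shift {𝒩 : ℤ → Submodule K N} (h : IsGradedModule (n := n) 𝒩) (s : ℤ) :
    IsGradedModule (n := n) fun d => 𝒩 (d - s) := by
  obtain ⟨π, -, h1, h2⟩ := exists_projections h.isInternal
  refine ⟨isInternal_of_projections ?_ (fun d => π (d - s)) (fun d => h1 _)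
    (fun d e hed => h2 _ _ (by omega)), fun i d p y hp hy => ?_⟩
  · rw [eq_top_iff, ← h.isInternal.submodule_iSup_eq_top]
    refine iSup_le fun d => ?_
    have := le_iSup (fun e => 𝒩 (e - s)) (d + s)
    simpa using this
  · have := h.smul_mem i (d - s) p y hp hy
    rwa [sub_add_eq_add_sub] at this

variable {N' : Type u} [AddCommGroup N'] [Module K N'] [Module (PolyRing K n) N']

theorem IsGradedModule.prod {𝒩 : ℤ → Submodule K N} {𝒩' : ℤ → Submodule K N'}
    (h : IsGradedModule (n := n) 𝒩) (h' : IsGradedModule (n := n) 𝒩') :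
    IsGradedModule (n := n) fun d => (𝒩 d).prod (𝒩' d) := by
  obtain ⟨π, -, h1, h2⟩ := exists_projections h.isInternal
  obtain ⟨π', -, h1', h2'⟩ := exists_projections h'.isInternal
  refine ⟨isInternal_of_projections ?_ (fun d => (π d).prodMap (π' d)) ?_ ?_, ?_⟩
  · rw [eq_top_iff, ← LinearMap.sup_range_inl_inr, LinearMap.range_eq_map, LinearMap.range_eq_map,
      ← h.isInternal.submodule_iSup_eq_top, ← h'.isInternal.submodule_iSup_eq_top,
      Submodule.map_iSup, Submodule.map_iSup]
    refine sup_le (iSup_mono fun d => ?_) (iSup_mono fun d => ?_)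
    · rintro _ ⟨y, hy, rfl⟩
      exact ⟨hy, Submodule.zero_mem _⟩
    · rintro _ ⟨y, hy, rfl⟩
      exact ⟨Submodule.zero_mem _, hy⟩
  · rintro d ⟨y, y'⟩ ⟨hy, hy'⟩
    exact Prod.ext (h1 d y hy) (h1' d y' hy')
  · rintro d e hed ⟨y, y'⟩ ⟨hy, hy'⟩
    exact Prod.ext (h2 d e hed y hy) (h2' d e hed y' hy')
  · rintro i d p ⟨y, y'⟩ hp ⟨hy, hy'⟩
    exact ⟨h.smul_mem i d p y hp hy, h'.smul_mem i d p y' hp hy'⟩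

end Shift

/-! ### Quotients by monomial ideals -/

section MonomialQuotient

variable {K : Type u} [Field K] {n : ℕ} {I : Ideal (PolyRing K n)} {A : (Fin n →₀ ℕ) → Prop}

theorem quotientGrading_natCast (I : Ideal (PolyRing K n)) (k : ℕ) :
    quotientGrading I (k : ℤ) = (MvPolynomial.homogeneousSubmodule (Fin n) K k).map
      (Ideal.Quotient.mkₐ K I).toLinearMap := by
  simp [quotientGrading]

theorem quotientGrading_of_neg (I : Ideal (PolyRing K n)) {d : ℤ} (hd : d < 0) :
    quotientGrading I d = ⊥ := by
  simp [quotientGrading, hd]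

/-- Since membership in `I` is tested monomial by monomial, homogeneous components preserve `I` and
descend to projections of the quotient. -/
theorem isGradedModule_quotientGrading (hI : ∀ f : PolyRing K n, f ∈ I ↔ ∀ a ∈ f.support, A a) :
    IsGradedModule (n := n) (quotientGrading I) := by
  have hcomp : ∀ (j : ℕ) (f : PolyRing K n), f ∈ I → MvPolynomial.homogeneousComponent j f ∈ I := by
    intro j f hf
    rw [hI] at hf ⊢
    intro a ha
    refine hf a ?_
    rw [MvPolynomial.mem_support_iff, MvPolynomial.coeff_homogeneousComponent] at ha
    rw [MvPolynomial.mem_support_iff]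
    intro h0
    simp [h0] at ha
  let c : ℕ → (PolyRing K n ⧸ I) →ₗ[K] (PolyRing K n ⧸ I) := fun j =>
    Submodule.liftQ (I.restrictScalars K)
      ((Ideal.Quotient.mkₐ K I).toLinearMap ∘ₗ MvPolynomial.homogeneousComponent j)
      (fun f hf => Ideal.Quotient.eq_zero_iff_mem.2 (hcomp j f hf)) ∘ₗ
      (Submodule.Quotient.restrictScalarsEquiv K I).symm.toLinearMap
  have hc : ∀ j f, c j (Ideal.Quotient.mk I f) =
      Ideal.Quotient.mk I (MvPolynomial.homogeneousComponent j f) := fun j f => rfl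
  refine ⟨isInternal_of_projections ?_ (fun d => if 0 ≤ d then c d.toNat else 0) ?_ ?_, ?_⟩
  · rw [eq_top_iff]
    intro y _
    obtain ⟨f, rfl⟩ := Ideal.Quotient.mk_surjective y
    rw [← MvPolynomial.sum_homogeneousComponent f, map_sum]
    refine Submodule.sum_mem _ fun j _ => Submodule.mem_iSup_of_mem (j : ℤ) ?_
    rw [quotientGrading_natCast]
    exact ⟨_, MvPolynomial.homogeneousComponent_isHomogeneous j f, rfl⟩
  · intro d y hy
    rcases lt_or_ge d 0 with hd | hd
    · rw [quotientGrading_of_neg I hd] at hy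
      rw [(Submodule.mem_bot K).1 hy, map_zero]
    · lift d to ℕ using hd
      rw [quotientGrading_natCast] at hy
      obtain ⟨f, hf, rfl⟩ := hy
      simp only [Int.natCast_nonneg, if_true, Int.toNat_natCast]
      refine (hc d f).trans ?_
      rw [MvPolynomial.homogeneousComponent_of_mem hf, if_pos rfl]
      rfl
  · intro d e hed y hy
    rcases lt_or_ge e 0 with he | he
    · rw [quotientGrading_of_neg I he] at hy
      rw [(Submodule.mem_bot K).1 hy, map_zero]
    · lift e to ℕ using he
      rw [quotientGrading_natCast] at hy
      obtain ⟨f, hf, rfl⟩ := hy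
      split_ifs with hd
      · lift d to ℕ using hd
        rw [Int.toNat_natCast]
        refine (hc d f).trans ?_
        rw [MvPolynomial.homogeneousComponent_of_mem hf, if_neg (by omega), map_zero]
      · rfl
  · intro i d p y hp hy
    rcases lt_or_ge d 0 with hd | hd
    · rw [quotientGrading_of_neg I hd] at hy
      rw [(Submodule.mem_bot K).1 hy, smul_zero]
      exact Submodule.zero_mem _
    · lift d to ℕ using hd
      rw [quotientGrading_natCast] at hy
      obtain ⟨f, hf, rfl⟩ := hy
      rw [← Nat.cast_add, quotientGrading_natCast]
      exact ⟨p * f, by rw [add_comm]; exact hp.mul hf, rfl⟩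

/-- The classes of the degree-k monomials outside `I` form a basis of the piece. -/
theorem hilbertFunction_quotientGrading_natCast [DecidablePred A]
    (hI : ∀ f : PolyRing K n, f ∈ I ↔ ∀ a ∈ f.support, A a) (k : ℕ) :
    hilbertFunction (quotientGrading I) k =
      (((Finset.univ : Finset (Fin n)).finsuppAntidiag k).filter fun a => ¬ A a).card := by
  set T := ((Finset.univ : Finset (Fin n)).finsuppAntidiag k).filter fun a => ¬ A a
  let b : T → PolyRing K n ⧸ I := fun a => Ideal.Quotient.mk I (MvPolynomial.monomial a.1 1)
  have hb : LinearIndependent K b := by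
    rw [Fintype.linearIndependent_iff]
    intro g hg a
    have hsum : ∑ a : T, MvPolynomial.monomial a.1 (g a) ∈ I := by
      rw [← Ideal.Quotient.eq_zero_iff_mem, map_sum, ← hg]
      refine Finset.sum_congr rfl fun a _ => ?_
      have : MvPolynomial.monomial a.1 (g a) = g a • MvPolynomial.monomial a.1 (1 : K) := by
        rw [MvPolynomial.smul_monomial, smul_eq_mul, mul_one]
      rw [this]
      rfl
    by_contra hne
    refine (Finset.mem_filter.1 a.2).2 ((hI _).1 hsum a.1 ?_)
    rw [MvPolynomial.mem_support_iff, MvPolynomial.coeff_sum, Finset.sum_eq_single a]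
    · simpa using hne
    · intro a' _ haa'
      rw [MvPolynomial.coeff_monomial, if_neg]
      exact fun h => haa' (Subtype.ext h)
    · simp
  have hspan : quotientGrading I k = Submodule.span K (Set.range b) := by
    rw [quotientGrading_natCast]
    apply le_antisymm
    · rintro _ ⟨f, hf, rfl⟩
      rw [MvPolynomial.as_sum f, map_sum]
      refine Submodule.sum_mem _ fun a ha => ?_
      have hmon : MvPolynomial.monomial a (f.coeff a) =
          f.coeff a • MvPolynomial.monomial a (1 : K) := by
        rw [MvPolynomial.smul_monomial, smul_eq_mul, mul_one]
      rw [hmon, map_smul]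
      refine Submodule.smul_mem _ _ ?_
      by_cases hA : A a
      · have : MvPolynomial.monomial a (1 : K) ∈ I := by
          rw [hI]
          intro a' ha'
          rw [Finset.mem_singleton.1 (MvPolynomial.support_monomial_subset ha')]
          exact hA
        have h0 : (Ideal.Quotient.mkₐ K I).toLinearMap (MvPolynomial.monomial a (1 : K)) = 0 :=
          Ideal.Quotient.eq_zero_iff_mem.2 this
        rw [h0]
        exact Submodule.zero_mem _
      · refine Submodule.subset_span ⟨⟨a, Finset.mem_filter.2 ⟨?_, hA⟩⟩, rfl⟩
        simp only [Finset.mem_finsuppAntidiag, Finset.subset_univ, and_true]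
        rw [← Finsupp.degree_eq_sum, Finsupp.degree_eq_weight_one]
        exact hf (MvPolynomial.mem_support_iff.1 ha)
    · rw [Submodule.span_le]
      rintro _ ⟨a, rfl⟩
      refine ⟨_, MvPolynomial.isHomogeneous_monomial (1 : K) ?_, rfl⟩
      have := (Finset.mem_finsuppAntidiag.1 (Finset.mem_filter.1 a.2).1).1
      rwa [Finsupp.degree_eq_sum]
  rw [hilbertFunction, hspan, finrank_span_eq_card hb, Fintype.card_coe]

theorem hilbertFunction_quotientGrading_of_neg (I : Ideal (PolyRing K n)) {d : ℤ} (hd : d < 0) :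
    hilbertFunction (quotientGrading I) d = 0 := by
  rw [hilbertFunction, quotientGrading_of_neg I hd, finrank_bot]

end MonomialQuotient

/-! ### Monomial descriptions of the ideals -/

section Membership

variable (K : Type u) [Field K] (n : ℕ)

/-- The ideal generated by the variables with index in `s`. -/
noncomputable def varIdeal (s : Set (Fin n)) : Ideal (PolyRing K n) :=
  Ideal.span (MvPolynomial.X '' s)

variable {K n}

theorem mem_varIdeal {s : Set (Fin n)} {f : PolyRing K n} :
    f ∈ varIdeal K n s ↔ ∀ a ∈ f.support, ∃ i ∈ s, a i ≠ 0 :=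
  MvPolynomial.mem_ideal_span_X_image

theorem mem_idealI {m : ℕ} {f : PolyRing K n} :
    f ∈ idealI K n m ↔ ∀ a ∈ f.support,
      (∀ i ∈ Finset.univ.filter (fun i : Fin n => (i : ℕ) < m), a i ≠ 0) ∧
        ∃ i ∈ {i : Fin n | m ≤ (i : ℕ)}, a i ≠ 0 := by
  have h1 : Ideal.span {∏ i ∈ Finset.univ.filter (fun i : Fin n => (i : ℕ) < m),
      (MvPolynomial.X i : PolyRing K n)} =
      Ideal.span ((fun s => MvPolynomial.monomial s (1 : K)) ''
        {∑ i ∈ Finset.univ.filter (fun i : Fin n => (i : ℕ) < m), Finsupp.single i 1}) := by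
    rw [Set.image_singleton, MvPolynomial.monomial_sum_one]
    rfl
  have h2 : Ideal.span {f : PolyRing K n | ∃ i : Fin n, m ≤ (i : ℕ) ∧ f = MvPolynomial.X i} =
      varIdeal K n {i : Fin n | m ≤ (i : ℕ)} := by
    rw [varIdeal]
    congr 1
    ext f
    simp [eq_comm]
  rw [idealI, Submodule.mem_inf, h1, h2, mem_varIdeal, MvPolynomial.mem_ideal_span_monomial_image,
    ← forall₂_and]
  refine forall₂_congr fun a _ => and_congr_left fun _ => ?_
  simp only [Set.mem_singleton_iff, exists_eq_left, Finsupp.le_def, Finsupp.finsetSum_apply,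
    Finsupp.single_apply, Finset.sum_ite_eq', Finset.mem_filter, Finset.mem_univ, true_and]
  refine forall_congr' fun i => ?_
  split_ifs with hi <;> simp [hi, Nat.one_le_iff_ne_zero]

end Membership

end HilbertDepth

namespace HilbertDepth
open PowerSeries

/-! ### Counting exponent vectors -/

section Counting

variable {ι : Type*} [DecidableEq ι]

/-- Subtracting the indicator vector of `t` is a bijection onto all exponents of degree k - |t|. -/
theorem card_filter_finsuppAntidiag (s t : Finset ι) (hts : t ⊆ s) (k : ℕ)
    [DecidablePred fun a : ι →₀ ℕ => ∀ i ∈ t, a i ≠ 0] :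
    ((s.finsuppAntidiag k).filter fun a : ι →₀ ℕ => ∀ i ∈ t, a i ≠ 0).card =
      if t.card ≤ k then (s.finsuppAntidiag (k - t.card)).card else 0 := by
  set b : ι →₀ ℕ := ∑ i ∈ t, Finsupp.single i 1
  have hb : ∀ i, b i = if i ∈ t then 1 else 0 := fun i => by
    simp [b, Finsupp.finsetSum_apply, Finsupp.single_apply]
  have hbs : ∑ i ∈ s, b i = t.card := by
    simp only [hb, Finset.sum_ite_mem, Finset.inter_eq_right.2 hts, Finset.sum_const, smul_eq_mul,
      mul_one]
  have hble : ∀ a : ι →₀ ℕ, (∀ i ∈ t, a i ≠ 0) ↔ b ≤ a := by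
    intro a
    rw [Finsupp.le_def]
    refine forall_congr' fun i => ?_
    rw [hb]
    split_ifs with hi <;> simp [hi, Nat.one_le_iff_ne_zero]
  split_ifs with hk
  · symm
    refine Finset.card_bij (fun a _ => a + b) ?_ (fun _ _ _ _ h => add_right_cancel h) ?_
    · intro a ha
      rw [Finset.mem_finsuppAntidiag] at ha
      rw [Finset.mem_filter, Finset.mem_finsuppAntidiag, hble]
      refine ⟨⟨?_, ?_⟩, le_add_self⟩
      · have : ∑ i ∈ s, a i = k - t.card := ha.1
        change ∑ i ∈ s, (a + b) i = k
        simp only [Finsupp.coe_add, Pi.add_apply, Finset.sum_add_distrib]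
        omega
      · refine Finsupp.support_add.trans (Finset.union_subset ha.2 fun i hi => hts ?_)
        by_contra hit
        rw [Finsupp.mem_support_iff, hb, if_neg hit] at hi
        exact hi rfl
    · intro a ha
      rw [Finset.mem_filter, Finset.mem_finsuppAntidiag, hble] at ha
      refine ⟨a - b, ?_, tsub_add_cancel_of_le ha.2⟩
      rw [Finset.mem_finsuppAntidiag]
      have h1 : ∑ i ∈ s, (a - b + b) i = k := by rw [tsub_add_cancel_of_le ha.2]; exact ha.1.1
      simp only [Pi.add_apply, Finset.sum_add_distrib, Finsupp.coe_add] at h1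
      refine ⟨show ∑ i ∈ s, (a - b) i = _ by omega, fun i hi => ha.1.2 ?_⟩
      rw [Finsupp.mem_support_iff] at hi ⊢
      intro h0
      simp [h0] at hi
  · rw [Finset.card_eq_zero, Finset.filter_eq_empty_iff]
    intro a ha hat
    rw [Finset.mem_finsuppAntidiag] at ha
    have h0 : ∑ i ∈ s, a i = k := ha.1
    have : ∑ i ∈ s, b i ≤ ∑ i ∈ s, a i := Finset.sum_le_sum fun i _ => (hble a).1 hat i
    omega

theorem filter_finsuppAntidiag_eq (s t : Finset ι) (hts : t ⊆ s) (k : ℕ)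
    [DecidablePred fun a : ι →₀ ℕ => ∀ i ∈ s \ t, a i = 0] :
    ((s.finsuppAntidiag k).filter fun a : ι →₀ ℕ => ∀ i ∈ s \ t, a i = 0) =
      t.finsuppAntidiag k := by
  ext a
  simp only [Finset.mem_filter, Finset.mem_finsuppAntidiag, Finset.mem_sdiff]
  constructor
  · rintro ⟨⟨h1, h2⟩, h3⟩
    refine ⟨?_, fun i hi => ?_⟩
    · rw [← h1]
      exact Finset.sum_subset hts fun i hi hit => h3 i ⟨hi, hit⟩
    · by_contra hit
      exact (Finsupp.mem_support_iff.1 hi) (h3 i ⟨h2 hi, hit⟩)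
  · rintro ⟨h1, h2⟩
    have h0 : ∀ i, i ∉ t → a i = 0 := fun i hit => by
      by_contra h
      exact hit (h2 (Finsupp.mem_support_iff.2 h))
    refine ⟨⟨?_, h2.trans hts⟩, fun i hi => h0 i hi.2⟩
    rw [← h1]
    exact (Finset.sum_subset hts fun i _ hit => h0 i hit).symm

end Counting

/-! ### Power series with poles at 1 -/

section Series

/-- The power series `1 / (1 - X) ^ r`. -/
noncomputable def geomPow (r : ℕ) : ℤ⟦X⟧ := (invOneSubPow ℤ r).val

/-- Truncated subtraction makes the formula correct for r = 0 too: it gives 1 at k = 0 and 0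
afterwards. -/
theorem coeff_geomPow (r k : ℕ) : coeff k (geomPow r) = ((r + k - 1).choose k : ℤ) := by
  rcases r with _ | r
  · rw [geomPow, invOneSubPow_zero]
    rcases k with _ | k <;> simp [coeff_one]
  · rw [geomPow, invOneSubPow_val_succ_eq_mk_add_choose, coeff_mk, Nat.choose_symm_add]
    congr 2
    omega

theorem geomPow_zero : geomPow 0 = 1 := by rw [geomPow, invOneSubPow_zero]; rfl

theorem geomPow_add (r s : ℕ) : geomPow (r + s) = geomPow r * geomPow s := by
  simp only [geomPow, invOneSubPow_add, Units.val_mul]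

theorem one_sub_pow_mul_geomPow (q : ℕ) : (1 - X) ^ q * geomPow q = 1 := by
  rw [geomPow, ← invOneSubPow_inv_eq_one_sub_pow]
  exact (invOneSubPow ℤ q).inv_val

theorem one_sub_pow_mul_geomPow_of_le {q r : ℕ} (h : q ≤ r) :
    (1 - X) ^ q * geomPow r = geomPow (r - q) := by
  obtain ⟨s, rfl⟩ := Nat.exists_eq_add_of_le h
  rw [geomPow_add, ← mul_assoc, one_sub_pow_mul_geomPow, one_mul, Nat.add_sub_cancel_left]

theorem one_sub_pow_mul_geomPow_of_ge {q r : ℕ} (h : r ≤ q) :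
    (1 - X) ^ q * geomPow r = (1 - X) ^ (q - r) := by
  obtain ⟨s, rfl⟩ := Nat.exists_eq_add_of_le h
  rw [pow_add, mul_right_comm, one_sub_pow_mul_geomPow, one_mul, Nat.add_sub_cancel_left]

theorem coeff_one_sub_X_pow (r k : ℕ) :
    coeff k ((1 - X : ℤ⟦X⟧) ^ r) = (-1) ^ k * (r.choose k : ℤ) := by
  have h : (1 - X : ℤ⟦X⟧) ^ r = rescale (-1 : ℤ) ((1 + Polynomial.X : Polynomial ℤ) ^ r :) := by
    simp [rescale_X, sub_eq_add_neg]
  rw [h, coeff_rescale, Polynomial.coeff_coe, Polynomial.coeff_one_add_X_pow]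

/-- The coefficients of a power series, extended by zero to negative indices. -/
noncomputable def intCoeff (F : ℤ⟦X⟧) (d : ℤ) : ℤ := if 0 ≤ d then coeff d.toNat F else 0

theorem intCoeff_natCast (F : ℤ⟦X⟧) (k : ℕ) : intCoeff F k = coeff k F := by
  simp [intCoeff]

theorem intCoeff_of_neg (F : ℤ⟦X⟧) {d : ℤ} (hd : d < 0) : intCoeff F d = 0 := by
  simp [intCoeff, hd]

theorem intCoeff_add (F G : ℤ⟦X⟧) (d : ℤ) : intCoeff (F + G) d = intCoeff F d + intCoeff G d := by
  unfold intCoeff; split_ifs <;> simp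

theorem intCoeff_X_pow_mul (s : ℕ) (F : ℤ⟦X⟧) (d : ℤ) :
    intCoeff (X ^ s * F) d = intCoeff F (d - s) := by
  rcases lt_or_ge d 0 with hd | hd
  · rw [intCoeff_of_neg _ hd, intCoeff_of_neg _ (by omega)]
  · lift d to ℕ using hd
    rw [intCoeff_natCast, coeff_X_pow_mul']
    split_ifs with h
    · rw [← Nat.cast_sub h, intCoeff_natCast]
    · rw [intCoeff_of_neg _ (by omega)]

theorem backwardDiff_intCoeff (F : ℤ⟦X⟧) :
    backwardDiff (intCoeff F) = intCoeff ((1 - X) * F) := by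
  funext d
  have h : F = (1 - X) * F + X ^ 1 * F := by ring
  have := intCoeff_add ((1 - X) * F) (X ^ 1 * F) d
  rw [← h, intCoeff_X_pow_mul] at this
  rw [backwardDiff, this]
  simp

theorem iterate_backwardDiff_intCoeff (q : ℕ) (F : ℤ⟦X⟧) :
    backwardDiff^[q] (intCoeff F) = intCoeff ((1 - X) ^ q * F) := by
  induction q generalizing F with
  | zero => simp
  | succ q ih => rw [Function.iterate_succ_apply, backwardDiff_intCoeff, ih, pow_succ, mul_assoc]

end Series

/-! ### Hilbert series of the quotients -/

section HilbertSeries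

variable (K : Type u) [Field K] {n : ℕ}

theorem hilbertFunction_varIdeal {r : ℕ} (hr : r ≤ n) (d : ℤ) :
    (hilbertFunction (quotientGrading (varIdeal K n {i : Fin n | r ≤ (i : ℕ)})) d : ℤ) =
      intCoeff (geomPow r) d := by
  classical
  rcases lt_or_ge d 0 with hd | hd
  · rw [hilbertFunction_quotientGrading_of_neg _ hd, intCoeff_of_neg _ hd, Nat.cast_zero]
  · lift d to ℕ using hd
    have h := filter_finsuppAntidiag_eq Finset.univ
      (Finset.univ.filter fun i : Fin n => (i : ℕ) < r) (Finset.subset_univ _) d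
    rw [intCoeff_natCast, hilbertFunction_quotientGrading_natCast (fun f => mem_varIdeal),
      coeff_geomPow]
    have h2 : (Finset.univ.filter fun i : Fin n => (i : ℕ) < r).card = r := by
      rw [Fin.card_filter_val_lt, min_eq_right hr]
    rw [← h2, ← Finset.card_finsuppAntidiag_nat_eq_choose, ← h, h2]
    congr 2
    ext a
    simp

/-- A monomial outside the ideal either misses one of x_1, …, x_m, which gives (1 - X^m)/(1 - X)^n,
or involves exactly these m variables, which gives X^m/(1 - X)^m. -/
theorem hilbertFunction_idealI {m : ℕ} (hm : m ≤ n) (d : ℤ) :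
    (hilbertFunction (quotientGrading (idealI K n m)) d : ℤ) =
      intCoeff (geomPow n - X ^ m * geomPow n + X ^ m * geomPow m) d := by
  classical
  rcases lt_or_ge d 0 with hd | hd
  · rw [hilbertFunction_quotientGrading_of_neg _ hd, intCoeff_of_neg _ hd, Nat.cast_zero]
  · lift d to ℕ using hd
    set t := Finset.univ.filter fun i : Fin n => (i : ℕ) < m with ht
    have htc : t.card = m := by rw [ht, Fin.card_filter_val_lt, min_eq_right hm]
    have h1 := card_filter_finsuppAntidiag Finset.univ t (Finset.subset_univ _) d
    have h2 := card_filter_finsuppAntidiag t t subset_rfl d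
    have h3 := filter_finsuppAntidiag_eq Finset.univ t (Finset.subset_univ _) d
    set W := (Finset.univ : Finset (Fin n)).finsuppAntidiag d
    have h3' : ∀ a, a ∈ t.finsuppAntidiag d ↔ a ∈ W ∧ ∀ i ∈ Finset.univ \ t, a i = 0 := fun a => by
      simpa only [Finset.mem_filter] using (Finset.ext_iff.1 h3 a).symm
    have logic : ∀ w p e : Prop, (w ∧ ¬(p ∧ e)) ↔ (w ∧ ¬p) ∨ ((w ∧ ¬e) ∧ p) := by tauto
    have h4 : hilbertFunction (quotientGrading (idealI K n m)) d =
        ((W.filter fun a : Fin n →₀ ℕ => ¬ ∀ i ∈ t, a i ≠ 0) ∪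
          ((t.finsuppAntidiag d).filter fun a => ∀ i ∈ t, a i ≠ 0)).card := by
      rw [hilbertFunction_quotientGrading_natCast (fun f => mem_idealI)]
      congr 1
      ext a
      have : (∀ i ∈ Finset.univ \ t, a i = 0) ↔ ¬ ∃ i ∈ {i : Fin n | m ≤ (i : ℕ)}, a i ≠ 0 := by
        simp [ht]
      refine Finset.mem_filter.trans (Iff.trans ?_ (Finset.mem_union.trans
        (or_congr Finset.mem_filter Finset.mem_filter)).symm)
      rw [h3', this]
      exact logic _ _ _
    have h5 : Disjoint (W.filter fun a : Fin n →₀ ℕ => ¬ ∀ i ∈ t, a i ≠ 0)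
        ((t.finsuppAntidiag d).filter fun a => ∀ i ∈ t, a i ≠ 0) :=
      Finset.disjoint_left.2 fun a ha ha' => (Finset.mem_filter.1 ha).2 (Finset.mem_filter.1 ha').2
    have h6 := Finset.card_filter_add_card_filter_not (s := W) fun a : Fin n →₀ ℕ => ∀ i ∈ t, a i ≠ 0
    rw [intCoeff_natCast, h4, Finset.card_union_of_disjoint h5, h2]
    rw [h1] at h6
    simp only [W, Finset.card_finsuppAntidiag_nat_eq_choose, htc, Finset.card_univ,
      Fintype.card_fin] at h6 ⊢
    rw [map_add, map_sub, coeff_X_pow_mul', coeff_X_pow_mul', coeff_geomPow]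
    split_ifs at h6 ⊢ with hmd
    · rw [coeff_geomPow, coeff_geomPow]
      push_cast
      omega
    · omega

end HilbertSeries

end HilbertDepth

namespace HilbertDepth
open PowerSeries

/-! ### Positivity of the numerator -/

section Numerator

/-- `(1 - X) ^ q` times the Hilbert series of `S / I_{n,m}`. -/
noncomputable def numerator (n m q : ℕ) : ℤ⟦X⟧ :=
  (1 - X) ^ q * (geomPow n - X ^ m * geomPow n + X ^ m * geomPow m)

theorem numerator_eq {n m q : ℕ} (hq : q ≤ n) : numerator n m q =
    geomPow (n - q) - X ^ m * geomPow (n - q) + X ^ m * ((1 - X) ^ q * geomPow m) := by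
  rw [numerator, ← one_sub_pow_mul_geomPow_of_le hq]
  ring

/-- The coefficients of 1/(1 - X)^e are nondecreasing as soon as e ≥ 1. -/
theorem coeff_X_pow_mul_geomPow_le {e : ℕ} (he : 1 ≤ e) (m k : ℕ) :
    coeff k (X ^ m * geomPow e) ≤ coeff k (geomPow e) := by
  obtain ⟨e, rfl⟩ := Nat.exists_eq_add_of_le' he
  rw [coeff_X_pow_mul']
  split_ifs with h
  · have h2 : ∀ j, coeff j (geomPow (e + 1)) = ((e + j).choose e : ℤ) := fun j => by
      rw [geomPow, invOneSubPow_val_succ_eq_mk_add_choose, coeff_mk]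
    rw [h2, h2]
    exact_mod_cast Nat.choose_mono e (by omega)
  · rw [coeff_geomPow]; positivity

/-- For q ≥ m the numerator is (1 - X^m)/(1 - X)^(n-q) + X^m (1 - X)^(q-m). The first term is
nonnegative when q < n, and the second is negative only for m ≤ k ≤ q with k - m odd. For q ≤ m the
second term is X^m/(1 - X)^(m-q), so nothing is negative. -/
theorem coeff_numerator_nonneg_iff {n m q : ℕ} (hm : 1 ≤ m) (hn : m + 1 ≤ n) (hq : q ≤ n) :
    (∀ k, 0 ≤ coeff k (numerator n m q)) ↔
      ∀ k : ℕ, m ≤ k → k ≤ q → Odd (k - m) →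
        ((n - q + k - 1).choose k : ℤ) - ((n - q + k - 1 - m).choose (k - m) : ℤ)
          ≥ ((q - m).choose (k - m) : ℤ) := by
  rw [numerator_eq hq]
  constructor
  · intro h k hmk hkq hodd
    have hk := h k
    rw [one_sub_pow_mul_geomPow_of_ge (hmk.trans hkq), map_add, map_sub, coeff_X_pow_mul',
      coeff_X_pow_mul', if_pos hmk, if_pos hmk, coeff_geomPow, coeff_geomPow, coeff_one_sub_X_pow,
      hodd.neg_one_pow] at hk
    have : n - q + (k - m) - 1 = n - q + k - 1 - m := by have := hodd.pos; omega
    rw [this] at hk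
    linarith
  · intro h k
    -- For q = n the inequality at k = m + 1 reads 0 ≥ n - m.
    have hqn : 1 ≤ n - q := by
      by_contra hlt
      obtain rfl : q = n := by omega
      have := h (m + 1) (by omega) hn (by simp)
      have h1 : q - q + (m + 1) - 1 = m := by omega
      have h2 : m + 1 - m = 1 := by omega
      rw [h1, h2, Nat.choose_succ_self, Nat.choose_one_right, Nat.choose_one_right] at this
      push_cast [Nat.cast_sub (show m ≤ q by omega)] at this
      have : (m : ℤ) + 1 ≤ q := by exact_mod_cast hn
      omega
    have hmono := coeff_X_pow_mul_geomPow_le hqn m k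
    rw [map_add, map_sub]
    rcases le_total q m with hqm | hmq
    · rw [one_sub_pow_mul_geomPow_of_le hqm]
      have : 0 ≤ coeff k (X ^ m * geomPow (m - q)) := by
        rw [coeff_X_pow_mul', coeff_geomPow]
        positivity
      linarith
    · rw [one_sub_pow_mul_geomPow_of_ge hmq, coeff_X_pow_mul' ((1 - X) ^ (q - m))]
      split_ifs with hmk
      · rw [coeff_one_sub_X_pow]
        rcases Nat.even_or_odd (k - m) with hev | hodd
        · rw [hev.neg_one_pow, one_mul]
          have : (0 : ℤ) ≤ ((q - m).choose (k - m) : ℤ) := by positivity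
          linarith
        · rw [hodd.neg_one_pow]
          rcases le_or_gt k q with hkq | hkq
          · have hk := h k hmk hkq hodd
            have : n - q + (k - m) - 1 = n - q + k - 1 - m := by omega
            rw [← this] at hk
            rw [coeff_X_pow_mul', if_pos hmk, coeff_geomPow, coeff_geomPow]
            linarith
          · rw [Nat.choose_eq_zero_of_lt (show q - m < k - m by omega)]
            simp only [Nat.cast_zero, mul_zero, add_zero]
            linarith
      · linarith

end Numerator

/-! ### Nonnegative sums of X^s/(1 - X)^r -/

section Decomposition

/-- The sums of series `X ^ s / (1 - X) ^ r` with `a ≤ r ≤ b`. -/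
noncomputable def geomMonoid (a b : ℕ) : AddSubmonoid ℤ⟦X⟧ :=
  AddSubmonoid.closure {F | ∃ s r : ℕ, a ≤ r ∧ r ≤ b ∧ F = X ^ s * geomPow r}

theorem X_pow_mul_geomPow_mem {a b r : ℕ} (s : ℕ) (ha : a ≤ r) (hb : r ≤ b) :
    X ^ s * geomPow r ∈ geomMonoid a b :=
  AddSubmonoid.subset_closure ⟨s, r, ha, hb, rfl⟩

theorem X_pow_mul_mem_geomMonoid {a b : ℕ} (L : ℕ) {F : ℤ⟦X⟧} (hF : F ∈ geomMonoid a b) :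
    X ^ L * F ∈ geomMonoid a b := by
  induction hF using AddSubmonoid.closure_induction with
  | mem F hF =>
    obtain ⟨s, r, ha, hb, rfl⟩ := hF
    rw [← mul_assoc, ← pow_add]
    exact X_pow_mul_geomPow_mem _ ha hb
  | zero => rw [mul_zero]; exact AddSubmonoid.zero_mem _
  | add F G _ _ hF hG => rw [mul_add]; exact AddSubmonoid.add_mem _ hF hG

theorem geomPow_mul_mem_geomMonoid {a b : ℕ} (q : ℕ) {F : ℤ⟦X⟧} (hF : F ∈ geomMonoid a b) :
    geomPow q * F ∈ geomMonoid (q + a) (q + b) := by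
  induction hF using AddSubmonoid.closure_induction with
  | mem F hF =>
    obtain ⟨s, r, ha, hb, rfl⟩ := hF
    rw [mul_left_comm, ← geomPow_add]
    exact X_pow_mul_geomPow_mem _ (by omega) (by omega)
  | zero => rw [mul_zero]; exact AddSubmonoid.zero_mem _
  | add F G _ _ hF hG => rw [mul_add]; exact AddSubmonoid.add_mem _ hF hG

/-- Telescoping of 1/(1 - X)^(i+1) - 1/(1 - X)^i = X/(1 - X)^(i+1). It shows that removing the
constant term and dividing by X stays inside `geomMonoid 0 b`. -/
theorem geomPow_eq_one_add (r : ℕ) :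
    geomPow r = 1 + X * ∑ i ∈ Finset.range r, geomPow (i + 1) := by
  induction r with
  | zero => simp [geomPow_zero]
  | succ r ih =>
    have h : (1 - X) ^ 1 * geomPow (r + 1) = geomPow r :=
      one_sub_pow_mul_geomPow_of_le (Nat.le_add_left 1 r)
    rw [Finset.sum_range_succ, mul_add, ← add_assoc, ← ih, ← h]
    ring

theorem exists_eq_C_add_X_mul {b : ℕ} {F : ℤ⟦X⟧} (hF : F ∈ geomMonoid 0 b) :
    ∃ c : ℤ, ∃ G ∈ geomMonoid 0 b, F = C c + X * G := by
  induction hF using AddSubmonoid.closure_induction with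
  | mem F hF =>
    obtain ⟨s, r, ha, hb, rfl⟩ := hF
    rcases s with _ | s
    · refine ⟨1, ∑ i ∈ Finset.range r, geomPow (i + 1), AddSubmonoid.sum_mem _ fun i hi => ?_, ?_⟩
      · rw [← one_mul (geomPow (i + 1)), ← pow_zero X]
        have := Finset.mem_range.1 hi
        exact X_pow_mul_geomPow_mem _ (by omega) (by omega)
      · rw [pow_zero, one_mul, map_one]
        exact geomPow_eq_one_add r
    · refine ⟨0, _, X_pow_mul_geomPow_mem s ha hb, ?_⟩
      rw [map_zero, zero_add, pow_succ']
      ring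
  | zero => exact ⟨0, 0, AddSubmonoid.zero_mem _, by simp⟩
  | add F F' _ _ hF hF' =>
    obtain ⟨c, G, hG, rfl⟩ := hF
    obtain ⟨c', G', hG', rfl⟩ := hF'
    exact ⟨c + c', G + G', AddSubmonoid.add_mem _ hG hG', by rw [map_add]; ring⟩

theorem exists_tail_mem_geomMonoid {b : ℕ} (L : ℕ) {F : ℤ⟦X⟧} (hF : F ∈ geomMonoid 0 b) :
    ∃ G ∈ geomMonoid 0 b, ∀ k, L ≤ k → coeff k F = coeff (k - L) G := by
  induction L with
  | zero => exact ⟨F, hF, fun k _ => rfl⟩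
  | succ L ih =>
    obtain ⟨G, hG, h⟩ := ih
    obtain ⟨c, G', hG', rfl⟩ := exists_eq_C_add_X_mul hG
    refine ⟨G', hG', fun k hk => ?_⟩
    obtain ⟨j, rfl⟩ := Nat.exists_eq_add_of_le' hk
    rw [h _ (by omega), show j + (L + 1) - L = j + 1 by omega, Nat.add_sub_cancel, map_add,
      coeff_succ_X_mul, coeff_C, if_neg (by omega), zero_add]

/-- Changing finitely many coefficients of a series in `geomMonoid 0 b` without making them negative
does not leave `geomMonoid 0 b`. -/
theorem mem_geomMonoid_of_eventually_eq {b L : ℕ} {F Q : ℤ⟦X⟧} (hF : F ∈ geomMonoid 0 b)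
    (hQ : ∀ k, 0 ≤ coeff k Q) (h : ∀ k, L ≤ k → coeff k Q = coeff k F) : Q ∈ geomMonoid 0 b := by
  obtain ⟨G, hG, hGF⟩ := exists_tail_mem_geomMonoid L hF
  -- Below degree L, Q is a nonnegative combination of powers X^k, available because r = 0 is
  -- allowed; from L on it is the shifted tail of F.
  have : Q = ∑ k ∈ Finset.range L, (coeff k Q).toNat • (X ^ k * geomPow 0) + X ^ L * G := by
    ext k
    rw [map_add, map_sum, coeff_X_pow_mul', geomPow_zero]
    have h1 : ∀ j, coeff k ((coeff j Q).toNat • (X ^ j * 1 : ℤ⟦X⟧)) =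
        if k = j then coeff j Q else 0 := by
      intro j
      rw [map_nsmul, mul_one, coeff_X_pow, nsmul_eq_mul, Int.toNat_of_nonneg (hQ j)]
      split_ifs <;> simp
    simp only [h1, Finset.sum_ite_eq, Finset.mem_range]
    by_cases hk : k < L
    · rw [if_pos hk, if_neg (by omega), add_zero]
    · rw [if_neg hk, if_pos (by omega), zero_add, h k (by omega), hGF k (by omega)]
  rw [this]
  exact AddSubmonoid.add_mem _ (AddSubmonoid.sum_mem _ fun k _ =>
    AddSubmonoid.nsmul_mem _ (X_pow_mul_geomPow_mem k le_rfl (Nat.zero_le b)) _)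
    (X_pow_mul_mem_geomMonoid L hG)

/-- Beyond degree q the numerator agrees with (1 - X^m)/(1 - X)^(n-q), which is the sum of X^j/(1 -
X)^(n-q-1) over j < m since q < n. Multiplying by 1/(1 - X)^q raises every exponent r by q. -/
theorem hilbertSeries_mem_geomMonoid {n m q : ℕ} (hmq : m ≤ q) (hqn : q < n)
    (h : ∀ k, 0 ≤ coeff k (numerator n m q)) :
    geomPow n - X ^ m * geomPow n + X ^ m * geomPow m ∈ geomMonoid q n := by
  have hF : geomPow (n - q) - X ^ m * geomPow (n - q) ∈ geomMonoid 0 (n - q) := by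
    have h1 : (1 - X) ^ 1 * geomPow (n - q) = geomPow (n - q - 1) :=
      one_sub_pow_mul_geomPow_of_le (by omega)
    have h2 : geomPow (n - q) - X ^ m * geomPow (n - q) =
        ∑ j ∈ Finset.range m, X ^ j * geomPow (n - q - 1) := by
      rw [← Finset.sum_mul, ← h1, ← one_sub_mul, ← geom_sum_mul_neg X m]
      ring
    rw [h2]
    exact AddSubmonoid.sum_mem _ fun j _ => X_pow_mul_geomPow_mem j (Nat.zero_le _) (by omega)
  have hQ : numerator n m q ∈ geomMonoid 0 (n - q) := by
    refine mem_geomMonoid_of_eventually_eq (L := q + 1) hF h fun k hk => ?_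
    rw [numerator_eq hqn.le, map_add, one_sub_pow_mul_geomPow_of_ge hmq,
      coeff_X_pow_mul' ((1 - X) ^ (q - m)), coeff_one_sub_X_pow, Nat.choose_eq_zero_of_lt (by omega)]
    simp
  have := geomPow_mul_mem_geomMonoid q hQ
  rw [numerator, ← mul_assoc, mul_comm (geomPow q), one_sub_pow_mul_geomPow, one_mul, add_zero,
    Nat.add_sub_cancel' hqn.le] at this
  exact this

end Decomposition

end HilbertDepth

namespace HilbertDepth
open RingTheory.Sequence

/-! ### Regularity of the initial variables -/

section VariableSequence

variable (K : Type u) [Field K] (n : ℕ)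

/-- The sequence of the first `q` variables. -/
noncomputable def varSeq (q : ℕ) : List (PolyRing K n) :=
  ((List.finRange n).map MvPolynomial.X).take q

variable {K n}

theorem length_varSeq {q : ℕ} (hq : q ≤ n) : (varSeq K n q).length = q := by
  simp [varSeq, hq]

theorem ofList_varSeq (q : ℕ) :
    Ideal.ofList (varSeq K n q) = varIdeal K n {i : Fin n | (i : ℕ) < q} := by
  rw [Ideal.ofList, varIdeal]
  congr 1
  ext f
  simp only [varSeq, Set.mem_ofPred_eq, List.mem_take_iff_getElem, List.getElem_map,
    List.getElem_finRange, List.length_map, List.length_finRange, Set.mem_image]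
  constructor
  · rintro ⟨i, hi, rfl⟩
    exact ⟨_, by simpa using (lt_min_iff.1 hi).1, rfl⟩
  · rintro ⟨i, hi, rfl⟩
    exact ⟨i, lt_min hi i.2, by simp⟩

theorem isWeaklyRegular_varSeq_iff {N : Type*} [AddCommGroup N] [Module (PolyRing K n) N] {q : ℕ}
    (hq : q ≤ n) : IsWeaklyRegular N (varSeq K n q) ↔ ∀ j : Fin n, (j : ℕ) < q → ∀ y : N,
      (MvPolynomial.X j : PolyRing K n) • y ∈
        (varIdeal K n {i | i < j} • ⊤ : Submodule (PolyRing K n) N) →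
      y ∈ (varIdeal K n {i | i < j} • ⊤ : Submodule (PolyRing K n) N) := by
  have htake : ∀ j < q, (varSeq K n q).take j = varSeq K n j := fun j hj => by
    rw [varSeq, List.take_take, min_eq_left hj.le, varSeq]
  have hset : ∀ j : Fin n, {i : Fin n | (i : ℕ) < j} = {i | i < j} := fun j => rfl
  rw [isWeaklyRegular_iff]
  constructor
  · intro h j hj
    have := h j (by rwa [length_varSeq hq])
    rw [htake _ hj, ofList_varSeq, hset, isSMulRegular_quotient_iff_mem_of_smul_mem] at this
    simpa [varSeq] using this
  · intro h j hj
    rw [length_varSeq hq] at hj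
    have := h ⟨j, hj.trans_le hq⟩ hj
    rw [htake _ hj, ofList_varSeq, isSMulRegular_quotient_iff_mem_of_smul_mem]
    simpa [varSeq] using! this

theorem mem_smul_top_prod {R N N' : Type*} [CommRing R] [AddCommGroup N] [Module R N]
    [AddCommGroup N'] [Module R N'] (I : Ideal R) (y : N × N') :
    y ∈ (I • ⊤ : Submodule R (N × N')) ↔
      y.1 ∈ (I • ⊤ : Submodule R N) ∧ y.2 ∈ (I • ⊤ : Submodule R N') := by
  constructor
  · intro h
    have h1 := Submodule.mem_map_of_mem (f := LinearMap.fst R N N') h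
    have h2 := Submodule.mem_map_of_mem (f := LinearMap.snd R N N') h
    rw [Submodule.map_smul''] at h1 h2
    exact ⟨Submodule.smul_mono le_rfl le_top h1, Submodule.smul_mono le_rfl le_top h2⟩
  · rintro ⟨h1, h2⟩
    replace h1 := Submodule.mem_map_of_mem (f := LinearMap.inl R N N') h1
    replace h2 := Submodule.mem_map_of_mem (f := LinearMap.inr R N N') h2
    rw [Submodule.map_smul''] at h1 h2
    have := Submodule.add_mem _ (Submodule.smul_mono le_rfl le_top h1)
      (Submodule.smul_mono le_rfl le_top h2)
    simpa using this

theorem mk_mem_smul_top_iff (s t : Set (Fin n)) (f : PolyRing K n) :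
    Ideal.Quotient.mk (varIdeal K n t) f ∈
      (varIdeal K n s • ⊤ : Submodule (PolyRing K n) (PolyRing K n ⧸ varIdeal K n t)) ↔
      f ∈ varIdeal K n (t ∪ s) := by
  have h1 : (varIdeal K n s • ⊤ : Submodule (PolyRing K n) (PolyRing K n ⧸ varIdeal K n t)) =
      Submodule.map (varIdeal K n t).mkQ (varIdeal K n s) := by
    rw [← Submodule.range_mkQ, LinearMap.range_eq_map, ← Submodule.map_smul'', smul_eq_mul,
      Ideal.mul_top]
  have h2 : varIdeal K n (t ∪ s) = varIdeal K n t ⊔ varIdeal K n s := by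
    rw [varIdeal, Set.image_union, Ideal.span_union]; rfl
  rw [h1, h2, ← Submodule.comap_map_mkQ]
  rfl

theorem mem_varIdeal_of_X_mul_mem {s : Set (Fin n)} {j : Fin n} (hj : j ∉ s) {f : PolyRing K n}
    (h : MvPolynomial.X j * f ∈ varIdeal K n s) : f ∈ varIdeal K n s := by
  rw [mem_varIdeal] at h ⊢
  intro a ha
  obtain ⟨i, hi, hai⟩ := h (Finsupp.single j 1 + a) (by
    rw [MvPolynomial.mem_support_iff, MvPolynomial.coeff_X_mul]
    exact MvPolynomial.mem_support_iff.1 ha)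
  refine ⟨i, hi, ?_⟩
  have hij : j ≠ i := fun h => hj (h ▸ hi)
  simpa [Finsupp.single_apply, hij] using hai

theorem one_notMem_varIdeal (s : Set (Fin n)) : (1 : PolyRing K n) ∉ varIdeal K n s := by
  rw [mem_varIdeal]
  intro h
  obtain ⟨i, -, hi⟩ := h 0 (by simp)
  exact hi rfl

end VariableSequence

/-! ### Realizing series by direct sums -/

section Realization

variable (K : Type u) [Field K] (n : ℕ)

/-- `F` is the Hilbert series of a finitely generated graded module on which the first `q`
variables form a weakly regular sequence, a regular one unless the module is zero. -/
def Realizes (q : ℕ) (F : PowerSeries ℤ) : Prop :=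
  ∃ (N : Type u) (_ : AddCommGroup N) (_ : Module K N) (_ : Module (PolyRing K n) N)
    (_ : IsScalarTower K (PolyRing K n) N) (𝒩 : ℤ → Submodule K N),
    IsGradedModule (n := n) 𝒩 ∧ Module.Finite (PolyRing K n) N ∧
    (∀ d : ℤ, (hilbertFunction 𝒩 d : ℤ) = intCoeff F d) ∧
    IsWeaklyRegular N (varSeq K n q) ∧
    ((⊤ : Submodule (PolyRing K n) N) = Ideal.ofList (varSeq K n q) • ⊤ → Subsingleton N)

variable {n}

theorem realizes_zero {q : ℕ} (hq : q ≤ n) : Realizes K n q 0 := by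
  refine ⟨PUnit.{u + 1}, inferInstance, inferInstance, inferInstance, inferInstance, fun _ => ⊥,
    ⟨isInternal_of_projections (Subsingleton.elim _ _) (fun _ => 0) (fun _ _ _ => rfl)
      (fun _ _ _ _ _ => rfl), fun _ _ _ _ _ _ => (Submodule.mem_bot K).2 (Subsingleton.elim _ _)⟩,
    inferInstance, fun d => ?_, ?_, fun _ => inferInstance⟩
  · rw [hilbertFunction, finrank_bot]
    unfold intCoeff
    split_ifs <;> simp
  · rw [isWeaklyRegular_varSeq_iff hq]
    intro j _ y _
    exact Subsingleton.elim (0 : PUnit) y ▸ zero_mem _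

/-- The module is K[x_1, …, x_r], seen as S/(x_{r+1}, …, x_n) and shifted by `s`; as q ≤ r, none of
the first `q` variables is killed. -/
theorem realizes_geomPow {q r : ℕ} (hqr : q ≤ r) (hr : r ≤ n) (s : ℕ) :
    Realizes K n q (PowerSeries.X ^ s * geomPow r) := by
  have hgr : IsGradedModule (n := n) (quotientGrading (varIdeal K n {i : Fin n | r ≤ (i : ℕ)})) :=
    isGradedModule_quotientGrading fun f => mem_varIdeal
  refine ⟨PolyRing K n ⧸ varIdeal K n {i : Fin n | r ≤ (i : ℕ)}, inferInstance, inferInstance,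
    inferInstance, inferInstance, _, hgr.shift s, inferInstance, fun d => ?_, ?_, fun h => ?_⟩
  · rw [intCoeff_X_pow_mul, ← hilbertFunction_varIdeal K hr]
    rfl
  · rw [isWeaklyRegular_varSeq_iff (hqr.trans hr)]
    intro j hj y hy
    obtain ⟨f, rfl⟩ := Ideal.Quotient.mk_surjective y
    have h1 : Ideal.Quotient.mk (varIdeal K n {i : Fin n | r ≤ (i : ℕ)}) (MvPolynomial.X j * f) ∈
      (varIdeal K n {i | i < j} • ⊤ : Submodule (PolyRing K n) _) := hy
    rw [mk_mem_smul_top_iff] at h1 ⊢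
    refine mem_varIdeal_of_X_mul_mem ?_ h1
    simp only [Set.mem_union, Set.mem_ofPred_eq, lt_irrefl, or_false]
    omega
  · exfalso
    have h1 : Ideal.Quotient.mk (varIdeal K n {i : Fin n | r ≤ (i : ℕ)}) 1 ∈
      (Ideal.ofList (varSeq K n q) • ⊤ : Submodule (PolyRing K n) _) := h ▸ Submodule.mem_top
    rw [ofList_varSeq, mk_mem_smul_top_iff] at h1
    exact one_notMem_varIdeal _ h1

variable {K}

theorem Realizes.add {q : ℕ} (hq : q ≤ n) {F G : PowerSeries ℤ} (hF : Realizes K n q F)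
    (hG : Realizes K n q G) : Realizes K n q (F + G) := by
  obtain ⟨N, _, _, _, _, 𝒩, hgr, hfin, hH, hreg, hne⟩ := hF
  obtain ⟨N', _, _, _, _, 𝒩', hgr', hfin', hH', hreg', hne'⟩ := hG
  refine ⟨N × N', inferInstance, inferInstance, inferInstance, inferInstance, _, hgr.prod hgr',
    inferInstance, fun d => ?_, ?_, fun h => ?_⟩
  · have := finiteDimensional_of_graded hgr.isInternal hgr.smul_mem d
    have := finiteDimensional_of_graded hgr'.isInternal hgr'.smul_mem d
    rw [intCoeff_add, ← hH, ← hH', ← Nat.cast_add]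
    congr 1
    have h1 : (𝒩 d).prod (𝒩' d) =
        LinearMap.range ((𝒩 d).subtype.prodMap (𝒩' d).subtype) := by
      rw [LinearMap.range_prodMap, Submodule.range_subtype, Submodule.range_subtype]
    rw [hilbertFunction, hilbertFunction, hilbertFunction, ← Module.finrank_prod, h1]
    exact LinearMap.finrank_range_of_inj ((Submodule.injective_subtype _).prodMap
      (Submodule.injective_subtype _))
  · rw [isWeaklyRegular_varSeq_iff hq] at hreg hreg' ⊢
    intro j hj y hy
    rw [mem_smul_top_prod] at hy ⊢
    exact ⟨hreg j hj _ hy.1, hreg' j hj _ hy.2⟩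
  · have h1 : ∀ y : N × N', y ∈ (Ideal.ofList (varSeq K n q) • ⊤ :
      Submodule (PolyRing K n) (N × N')) := fun y => h ▸ Submodule.mem_top
    have := hne (eq_top_iff.2 fun y _ => ((mem_smul_top_prod _ _).1 (h1 (y, 0))).1).symm
    have := hne' (eq_top_iff.2 fun y _ => ((mem_smul_top_prod _ _).1 (h1 (0, y))).2).symm
    infer_instance

theorem realizes_of_mem_geomMonoid {q : ℕ} (hq : q ≤ n) {F : PowerSeries ℤ}
    (hF : F ∈ geomMonoid q n) : Realizes K n q F := by
  induction hF using AddSubmonoid.closure_induction with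
  | mem F hF =>
    obtain ⟨s, r, ha, hb, rfl⟩ := hF
    exact realizes_geomPow K ha hb s
  | zero => exact realizes_zero K hq
  | add F G _ _ hF hG => exact hF.add hq hG

end Realization

end HilbertDepth

/-! ### The two bounds combined -/

open HilbertDepth in
theorem mainTheorem4 {K : Type*} [Field K] (n m : ℕ) (hm : 1 ≤ m) (hn : m + 1 ≤ n) :
    IsGreatest
        (HilbertDepth.depthsWithHilbertSeriesOf n
          (HilbertDepth.quotientGrading (HilbertDepth.idealI K n m)))
        (HilbertDepth.hdepth n (HilbertDepth.quotientGrading (HilbertDepth.idealI K n m))) ∧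
      ∃ h : ℕ,
        HilbertDepth.hdepth n (HilbertDepth.quotientGrading (HilbertDepth.idealI K n m)) = h ∧
        IsGreatest
          {q : ℕ | q ≤ n ∧ ∀ k : ℕ, m ≤ k → k ≤ q → Odd (k - m) →
            ((n - q + k - 1).choose k : ℤ) - ((n - q + k - 1 - m).choose (k - m) : ℤ)
              ≥ ((q - m).choose (k - m) : ℤ)}
          h := by
  set A := {q : ℕ | q ≤ n ∧ ∀ k : ℕ, m ≤ k → k ≤ q → Odd (k - m) →
            ((n - q + k - 1).choose k : ℤ) - ((n - q + k - 1 - m).choose (k - m) : ℤ)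
              ≥ ((q - m).choose (k - m) : ℤ)} with hA
  have hAiff : ∀ q, q ∈ A ↔ q ≤ n ∧ ∀ k, 0 ≤ PowerSeries.coeff k (numerator n m q) := by
    intro q
    refine and_congr_right fun hq => ?_
    rw [coeff_numerator_nonneg_iff hm hn hq]
  -- For q = m the only candidate is k = m, and k - m = 0 is even.
  have hmA : m ∈ A := ⟨by omega, fun k h1 h2 h3 => by
    obtain rfl : k = m := le_antisymm h2 h1
    simp at h3⟩
  have hnA : n ∉ A := by
    rintro ⟨-, h⟩
    have := h (m + 1) (by omega) hn (by simp)
    have h1 : n - n + (m + 1) - 1 = m := by omega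
    have h2 : m + 1 - m = 1 := by omega
    rw [h1, h2, Nat.choose_succ_self, Nat.choose_one_right, Nat.choose_one_right] at this
    omega
  obtain ⟨h, hgreat⟩ : ∃ h, IsGreatest A h := by
    have hbdd : BddAbove A := ⟨n, fun q hq => hq.1⟩
    exact ⟨sSup A, Nat.sSup_mem ⟨m, hmA⟩ hbdd, fun q hq => le_csSup hbdd hq⟩
  have hhn : h < n := lt_of_le_of_ne hgreat.1.1 fun e => hnA (e ▸ hgreat.1)
  have hmh : m ≤ h := hgreat.2 hmA
  have hupper : ∀ e ∈ depthsWithHilbertSeriesOf n (quotientGrading (idealI K n m)), e ≤ (h : ℕ∞) := by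
    rintro e ⟨N, _, _, _, _, 𝒩, hgr, hfin, hH, rfl⟩
    refine iSup_le ?_
    rintro ⟨rs, hrs, hmem⟩
    have key : ∀ q ≤ n, q ≤ rs.length → q ∈ A := by
      intro q hqn hq
      rw [hAiff]
      refine ⟨hqn, fun k => ?_⟩
      have h1 := iterate_backwardDiff_hilbertFunction_nonneg hgr.isInternal hgr.smul_mem
        (isWeaklyRegular_take hrs.toIsWeaklyRegular q)
        (fun f hf => hmem f (List.mem_of_mem_take hf)) k
      have h2 : (fun d => (hilbertFunction 𝒩 d : ℤ)) = intCoeff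
          (geomPow n - PowerSeries.X ^ m * geomPow n + PowerSeries.X ^ m * geomPow m) := by
        funext d
        rw [hH, hilbertFunction_idealI K (by omega)]
      rwa [List.length_take, min_eq_left hq, h2, iterate_backwardDiff_intCoeff, intCoeff_natCast]
        at h1
    -- A longer sequence could be truncated to length n, putting n in `A`.
    have hlen : rs.length ≤ n := by
      by_contra hlt
      exact hnA (key n le_rfl (by omega))
    exact_mod_cast hgreat.2 (key _ hlen le_rfl)
  have hmem : (h : ℕ∞) ∈ depthsWithHilbertSeriesOf n (quotientGrading (idealI K n m)) := by
    obtain ⟨N, _, _, _, _, 𝒩, hgr, hfin, hH, hreg, hne⟩ := realizes_of_mem_geomMonoid (K := K) hhn.le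
      (hilbertSeries_mem_geomMonoid hmh hhn ((hAiff h).1 hgreat.1).2)
    have hHf : ∀ d, hilbertFunction 𝒩 d = hilbertFunction (quotientGrading (idealI K n m)) d := by
      intro d
      have := hilbertFunction_idealI K (show m ≤ n by omega) d
      rw [← hH] at this
      exact_mod_cast this.symm
    refine ⟨N, _, _, _, inferInstance, 𝒩, hgr, hfin, hHf, le_antisymm
      (hupper _ ⟨N, _, _, _, inferInstance, 𝒩, hgr, hfin, hHf, rfl⟩) ?_⟩
    -- The constant coefficient of the series is 1, because m ≥ 1.
    have hnt : ¬ Subsingleton N := by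
      intro hs
      have h0 := hH ((0 : ℕ) : ℤ)
      rw [intCoeff_natCast, hilbertFunction, Module.finrank_zero_of_subsingleton, map_add, map_sub,
        PowerSeries.coeff_X_pow_mul', PowerSeries.coeff_X_pow_mul', if_neg (by omega),
        if_neg (by omega), coeff_geomPow] at h0
      simp at h0
    have hle := le_iSup (fun rs : {rs : List (PolyRing K n) // RingTheory.Sequence.IsRegular N rs ∧
      ∀ f ∈ rs, f ∈ Ideal.span (Set.range (MvPolynomial.X : Fin n → PolyRing K n))} =>
        (rs.1.length : ℕ∞)) ⟨varSeq K n h, ⟨hreg, fun e => hnt (hne e)⟩, fun f hf => by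
          obtain ⟨i, -, rfl⟩ := List.mem_map.1 (List.mem_of_mem_take hf)
          exact Ideal.subset_span ⟨i, rfl⟩⟩
    rwa [length_varSeq hhn.le] at hle
  have hdep : hdepth n (quotientGrading (idealI K n m)) = h :=
    le_antisymm (sSup_le hupper) (le_sSup hmem)
  rw [hdep]
  exact ⟨⟨hmem, hupper⟩, h, rfl, hgreat⟩
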